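/- Let $\alpha$ be a regular cardinal and let $\mathcal K$ be a locally $\alpha$-presentable category whose full subcategory $\mathcal K_\alpha$ of $\alpha$-presentable objects is $\alpha$-complete (has all limits of diagrams with fewer than $\alpha$ arrows). Let $\widehat{\mathcal K}=\mathrm{Ind}_\alpha(\mathcal K_\alpha^{op})$ be the free cocompletion of $\mathcal K_\alpha^{op}$ under small $\alpha$-filtered colimits, i.e. the category of those presheaves on $\mathcal K_\alpha^{op}$ that are small $\alpha$-filtered colimits of representables; let $H\colon\mathcal K_\alpha\to\mathcal K$ and $J\colon\mathcal K_\alpha^{op}\to\widehat{\mathcal K}$ be the inclusions, and let $\alpha\text{-}\mathrm{Filt}(\widehat{\mathcal K},\mathbf{Set})$ be the category of functors $\widehat{\mathcal K}\to\mathbf{Set}$ preserving small $\alpha$-filtered colimits. Let $$G\colon\mathcal K\to\alpha\text{-}\mathrm{Filt}(\widehat{\mathcal K},\mathbf{Set}),\qquad GX=\mathrm{Lan}_J\,\mathcal K(H-,X).$$ Let $\gamma$ be any regular cardinal such that $\mathcal K_\alpha$ has fewer than $\gamma$ objects up to isomorphism and such that there is a cardinal $\beta<\gamma$ with $\#\mathcal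 K(X,Y)<\beta$ for all $X,Y\in\mathcal K_\alpha$. Then an object $X$ of $\mathcal K$ is $\alpha$-presentable if and only if $GX$ preserves $\gamma$-small products (products of families indexed by a set of cardinality less than $\gamma$). Example. The category $\mathbf{Bool}$ of Boolean algebras is locally finitely presentable and, for $\mathcal K=\mathbf{Bool}$ and $\alpha=\aleph_0$, there is an equivalence $E\colon\mathbf{Set}\simeq\widehat{\mathbf{Bool}}$ under which, for every Boolean algebra $B$, the functor $GB$ is naturally isomorphic to the functor $\mathbf{Set}\to\mathbf{Set}$ $$X\mapsto\{f\colon X\to B \text{ of finite support}\mid \textstyle\bigvee_{i} f(i)=1,\ f(i)\wedge f(j)=0\ \text{for } i\neq j\},$$ where $h\colon X\to Y$ sends $f$ to the function $y\mapsto\bigvee_{h(x)=y}f(x)$. A Boolean algebra $B$ is finite if and only if this functor preserves countable products. -/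

import Mathlib

open CategoryTheory Limits Opposite

universe w u

/-! ### Ind-completion at a regular cardinal -/

/-- The presheaf `P` is a colimit of representables along a small `κ`-filtered diagram. -/
def IsCardinalInd {C : Type u} [Category.{w} C] (κ : Cardinal.{w}) [Fact κ.IsRegular] :
    ObjectProperty (Cᵒᵖ ⥤ Type w) := fun P =>
  ∃ (I : Type w) (_ : SmallCategory I) (_ : IsCardinalFiltered I κ) (F : I ⥤ C)
    (ι : F ⋙ yoneda ⟶ (Functor.const I).obj P), Nonempty (IsColimit (Cocone.mk P ι))

/-- `Ind_κ(C)`, the free cocompletion of `C` under small `κ`-filtered colimits: the full subcategory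
of presheaves on `C` that are small `κ`-filtered colimits of representables. -/
abbrev CardinalInd (C : Type u) [Category.{w} C] (κ : Cardinal.{w}) [Fact κ.IsRegular] :=
  (IsCardinalInd (C := C) κ).FullSubcategory

theorem isCardinalInd_yoneda {C : Type u} [Category.{w} C] (κ : Cardinal.{w}) [Fact κ.IsRegular]
    (X : C) : IsCardinalInd κ (yoneda.obj X) := by
  let p := IndObjectPresentation.yoneda X
  refine ⟨Discrete PUnit.{w+1}, inferInstance, ?_, p.F, p.ι, ⟨p.isColimit⟩⟩
  exact isCardinalFiltered_of_hasTerminal _ _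

/-- The inclusion `C ⥤ Ind_κ(C)` given by the Yoneda embedding. -/
def CardinalInd.embedding (C : Type u) [Category.{w} C] (κ : Cardinal.{w}) [Fact κ.IsRegular] :
    C ⥤ CardinalInd C κ :=
  ObjectProperty.lift _ yoneda (isCardinalInd_yoneda κ)

theorem IsCardinalInd.isCardinalFiltered {C : Type u} [Category.{w} C] {κ : Cardinal.{w}}
    [Fact κ.IsRegular] {P : Cᵒᵖ ⥤ Type w} (h : IsCardinalInd κ P) :
    IsCardinalFiltered (CostructuredArrow yoneda P) κ := by
  obtain ⟨I, _, _, F, ι, ⟨hc⟩⟩ := h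
  have := Presheaf.final_toCostructuredArrow_comp_pre F hc
  exact IsCardinalFiltered.of_final ((Cocone.mk P ι).toCostructuredArrow ⋙
    CostructuredArrow.pre F yoneda P) κ

instance presheaf_locallySmall (C : Type u) [Category.{w} C] [EssentiallySmall.{w} C] :
    LocallySmall.{w} (Cᵒᵖ ⥤ Type w) :=
  locallySmall_of_faithful ((equivSmallModel.{w} C).op.congrLeft (E := Type w)).functor

theorem isCardinalInd_of_isCardinalFiltered {C : Type u} [Category.{w} C] [EssentiallySmall.{w} C]
    {κ : Cardinal.{w}}
    [Fact κ.IsRegular] {P : Cᵒᵖ ⥤ Type w} [IsCardinalFiltered (CostructuredArrow yoneda P) κ] :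
    IsCardinalInd κ P := by
  let e := equivSmallModel.{w} (CostructuredArrow yoneda P)
  refine ⟨SmallModel.{w} (CostructuredArrow yoneda P), inferInstance,
    IsCardinalFiltered.of_equivalence κ e, e.inverse ⋙ CostructuredArrow.proj _ _,
    ((Presheaf.tautologicalCocone P).whisker e.inverse).ι,
    ⟨(Functor.Final.isColimitWhiskerEquiv _ _).symm (Presheaf.isColimitTautologicalCocone P)⟩⟩

/-- `Ind_κ(C)` is closed under `κ`-filtered colimits of presheaves. -/
theorem isCardinalInd_of_isColimit {C : Type u} [Category.{w} C] [EssentiallySmall.{w} C]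
    {κ : Cardinal.{w}} [Fact κ.IsRegular] {I : Type w} [SmallCategory I] [IsCardinalFiltered I κ]
    (D : I ⥤ Cᵒᵖ ⥤ Type w) (hD : ∀ i, IsCardinalInd κ (D.obj i)) (c : Cocone D)
    (hc : IsColimit c) : IsCardinalInd κ c.pt := by
  have := isFiltered_of_isCardinalFiltered I κ
  have hev (a : C) := isColimitOfPreserves ((evaluation Cᵒᵖ (Type w)).obj (op a)) hc
  have hfil (i : I) := (hD i).isCardinalFiltered
  suffices IsCardinalFiltered (CostructuredArrow yoneda c.pt) κ from
    isCardinalInd_of_isCardinalFiltered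
  -- every map from a representable to the colimit factors through a stage
  have lift (f : CostructuredArrow yoneda c.pt) :
      ∃ (i : I) (x : yoneda.obj f.left ⟶ D.obj i), x ≫ c.ι.app i = f.hom := by
    obtain ⟨i, x, hx⟩ := Types.jointly_surjective_of_isColimit (hev f.left) (yonedaEquiv f.hom)
    refine ⟨i, yonedaEquiv.symm x, yonedaEquiv.injective ?_⟩
    rw [yonedaEquiv_comp]
    simpa using hx
  have eqv {a : C} {i : I} (x y : yoneda.obj a ⟶ D.obj i) (h : x ≫ c.ι.app i = y ≫ c.ι.app i) :
      ∃ (j : I) (u : i ⟶ j), x ≫ D.map u = y ≫ D.map u := by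
    have h' := congrArg yonedaEquiv h
    rw [yonedaEquiv_comp, yonedaEquiv_comp] at h'
    obtain ⟨j, u, hu⟩ := (Types.FilteredColimit.isColimit_eq_iff' (hev a) _ _).mp h'
    refine ⟨j, u, yonedaEquiv.injective ?_⟩
    rw [yonedaEquiv_comp, yonedaEquiv_comp]
    exact hu
  rw [isCardinalFiltered_iff]
  refine ⟨fun ι f hι => ?_, fun ι f g t hι => ?_⟩
  · choose i x hx using fun k => lift (f k)
    let m := IsCardinalFiltered.max i hι
    let y (k : ι) : CostructuredArrow yoneda (D.obj m) :=
      CostructuredArrow.mk (x k ≫ D.map (IsCardinalFiltered.toMax i hι k))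
    refine ⟨(CostructuredArrow.map (c.ι.app m)).obj (IsCardinalFiltered.max y hι), fun k => ⟨?_⟩⟩
    have hk : (CostructuredArrow.map (c.ι.app m)).obj (y k) = f k := by
      rw [CostructuredArrow.eq_mk (f k)]
      simp [y, hx, CostructuredArrow.map_mk]
    exact eqToHom hk.symm ≫ (CostructuredArrow.map (c.ι.app m)).map
      (IsCardinalFiltered.toMax y hι k)
  · obtain ⟨i, x, hx⟩ := lift f
    obtain ⟨j, y, hy⟩ := lift g
    obtain ⟨m, ui, uj, -⟩ : ∃ (m : I) (_ : i ⟶ m) (_ : j ⟶ m), True :=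
      ⟨_, IsFiltered.leftToMax i j, IsFiltered.rightToMax i j, trivial⟩
    have h1 (k : ι) : (yoneda.map (t k).left ≫ y ≫ D.map uj) ≫ c.ι.app m =
        (x ≫ D.map ui) ≫ c.ι.app m := by
      simp [hx, hy]
    choose n v hv using fun k => eqv _ _ (h1 k)
    obtain ⟨l, v', v'', hl⟩ := IsCardinalFiltered.wideSpan v hι
    let g' : CostructuredArrow yoneda (D.obj l) := CostructuredArrow.mk (y ≫ D.map uj ≫ D.map v'')
    let f' : CostructuredArrow yoneda (D.obj l) := CostructuredArrow.mk (x ≫ D.map ui ≫ D.map v'')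
    let t' (k : ι) : f' ⟶ g' := CostructuredArrow.homMk (t k).left (by
      have := hv k =≫ D.map (v' k)
      simp only [Category.assoc, ← D.map_comp, hl] at this
      simpa [f', g'] using this)
    let q := IsCardinalFiltered.coeqHom t' hι
    let b := IsCardinalFiltered.toCoeq t' hι
    have hq : yoneda.map q.left ≫ (IsCardinalFiltered.coeq t' hι).hom = g'.hom :=
      CostructuredArrow.w q
    have hb : yoneda.map b.left ≫ (IsCardinalFiltered.coeq t' hι).hom = f'.hom :=
      CostructuredArrow.w b
    refine ⟨(CostructuredArrow.map (c.ι.app l)).obj (IsCardinalFiltered.coeq t' hι),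
      CostructuredArrow.homMk q.left ?_, CostructuredArrow.homMk b.left ?_, fun k => ?_⟩
    · have := hq =≫ c.ι.app l
      simp [g', hy]
    · have := hb =≫ c.ι.app l
      simp [f', hx]
    · ext
      exact congrArg (fun r => r.left) (IsCardinalFiltered.coeq_condition t' hι k)

instance (C : Type u) [Category.{w} C] [EssentiallySmall.{w} C] (κ : Cardinal.{w})
    [Fact κ.IsRegular] (I : Type w) [SmallCategory I] [IsCardinalFiltered I κ] :
    (IsCardinalInd (C := C) κ).IsClosedUnderColimitsOfShape I where
  colimitsOfShape_le := by
    rintro P ⟨p⟩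
    exact isCardinalInd_of_isColimit p.diag p.prop_diag_obj _ p.isColimit

instance (C : Type u) [Category.{w} C] [EssentiallySmall.{w} C] (κ : Cardinal.{w})
    [Fact κ.IsRegular] : (IsCardinalInd (C := C) κ).ι.IsCardinalAccessible κ where
  preservesColimitOfShape I _ _ := by
    infer_instance

instance (C : Type u) [Category.{w} C] [EssentiallySmall.{w} C] (κ : Cardinal.{w})
    [Fact κ.IsRegular] : LocallySmall.{w} (CardinalInd C κ) :=
  locallySmall_of_faithful (IsCardinalInd (C := C) κ).ι

instance (C : Type u) [Category.{w} C] [EssentiallySmall.{w} C] (κ : Cardinal.{w})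
    [Fact κ.IsRegular] (M : C ⥤ Type w) :
    (CardinalInd.embedding C κ).HasPointwiseLeftKanExtension M := fun P =>
  have := hasColimitsOfShape_of_essentiallySmall.{w}
    (CostructuredArrow (CardinalInd.embedding C κ) P) (Type w)
  inferInstanceAs (HasColimit _)

/-- Left Kan extensions along `C ⥤ Ind_κ(C)` preserve `κ`-filtered colimits. -/
theorem isCardinalAccessible_lan_embedding (C : Type u) [Category.{w} C] [EssentiallySmall.{w} C] (κ : Cardinal.{w})
    [Fact κ.IsRegular] (M : C ⥤ Type w) :
    ((CardinalInd.embedding C κ).lan.obj M).IsCardinalAccessible κ := by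
  let Y : C ⥤ Cᵒᵖ ⥤ Type w := uliftYoneda.{w}
  have : Y.HasPointwiseLeftKanExtension M := fun P =>
    have := hasColimitsOfShape_of_essentiallySmall.{w} (CostructuredArrow Y P) (Type w)
    inferInstanceAs (HasColimit _)
  let N := Y.leftKanExtension M
  have hN : PreservesColimitsOfSize.{w, w} N :=
    Presheaf.preservesColimitsOfSize_of_isLeftKanExtension N (Y.leftKanExtensionUnit M)
  let S := CardinalInd.embedding C κ
  let e : S ⋙ (IsCardinalInd κ).ι ≅ Y := (uliftYonedaIsoYoneda.{w} (C := C)).symm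
  let β : M ⟶ S ⋙ (IsCardinalInd κ).ι ⋙ N :=
    Y.leftKanExtensionUnit M ≫ Functor.whiskerRight e.inv N
  have hβ : (Functor.LeftExtension.mk _ β).IsPointwiseLeftKanExtension := fun P => by
    let T : CostructuredArrow S P ⥤ CostructuredArrow Y P.obj :=
      CostructuredArrow.post S (IsCardinalInd κ).ι P ⋙ (CostructuredArrow.mapNatIso e).functor
    have : T.IsEquivalence := inferInstance
    have h := Functor.isPointwiseLeftKanExtensionOfIsLeftKanExtension N
      (Y.leftKanExtensionUnit M) P.obj
    refine IsColimit.ofIsoColimit ((Functor.Final.isColimitWhiskerEquiv T _).symm h)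
      (Cocone.ext (Iso.refl _) fun f => ?_)
    simp [T, β]
    exact (Category.comp_id _).trans (Category.assoc _ _ _).symm
  have : ((IsCardinalInd κ).ι ⋙ N).IsLeftKanExtension β := hβ.isLeftKanExtension
  have i := Functor.leftKanExtensionUnique _ ((CardinalInd.embedding C κ).lanUnit.app M) _ β
  exact Functor.isCardinalAccessible_of_natIso i.symm κ

/-! ### The canonical functor -/

/-- The full subcategory `K_α` of `α`-presentable objects. -/
abbrev PresentableObjects (K : Type u) [Category.{w} K] (α : Cardinal.{w}) [Fact α.IsRegular] :=
  (isCardinalPresentable K α).FullSubcategory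

/-- `α`-Filt(`D`, Set): the functors `D ⥤ Type w` preserving small `α`-filtered colimits. -/
abbrev CardinalFilt (D : Type*) [Category* D] (α : Cardinal.{w}) [Fact α.IsRegular] :=
  ObjectProperty.FullSubcategory (fun F : D ⥤ Type w => F.IsCardinalAccessible α)

/-- The functor `X ↦ K(H -, X)`, where `H` is the inclusion of `K_α` in `K`. -/
def restrictedHom (K : Type u) [Category.{w} K] (α : Cardinal.{w}) [Fact α.IsRegular] :
    K ⥤ ((PresentableObjects K α)ᵒᵖ ⥤ Type w) :=
  yoneda ⋙ (Functor.whiskeringLeft _ _ _).obj (isCardinalPresentable K α).ι.op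

/-- The canonical functor `G : K ⥤ α-Filt(Ind_α(K_αᵒᵖ), Set)`, sending `X` to the left Kan
extension of `K(H -, X)` along the inclusion `J : K_αᵒᵖ ⥤ Ind_α(K_αᵒᵖ)`. -/
noncomputable def canonicalFunctor (K : Type u) [Category.{w} K] (α : Cardinal.{w})
    [Fact α.IsRegular] [IsCardinalLocallyPresentable K α] :
    K ⥤ CardinalFilt (CardinalInd (PresentableObjects K α)ᵒᵖ α) α :=
  ObjectProperty.lift _
    (restrictedHom K α ⋙ (CardinalInd.embedding (PresentableObjects K α)ᵒᵖ α).lan)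
    (fun X => isCardinalAccessible_lan_embedding _ α ((restrictedHom K α).obj X))

/-- `C` is `α`-complete: it has limits of all diagrams with fewer than `α` arrows. -/
def IsCardinalComplete (C : Type u) [Category.{w} C] (α : Cardinal.{w}) : Prop :=
  ∀ (A : Type w) [SmallCategory A], HasCardinalLT (Arrow A) α → HasLimitsOfShape A C

/-- `F` preserves `γ`-small products, i.e. those indexed by sets of cardinality `< γ`. -/
def PreservesSmallProducts {D : Type*} [Category* D] (F : D ⥤ Type w) (γ : Cardinal.{w}) : Prop :=
  ∀ I : Type w, HasCardinalLT I γ → PreservesLimitsOfShape (Discrete I) F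

/-- The condition on the regular cardinal `γ`: up to isomorphism `C` has fewer than `γ` objects,
and for some `β < γ` all hom-sets of `C` have fewer than `β` elements. -/
structure BoundsCategory (C : Type u) [Category.{w} C] (γ : Cardinal.{w}) : Prop where
  isRegular : γ.IsRegular
  objects : HasCardinalLT (Quotient (isIsomorphicSetoid C)) γ
  homs : ∃ β < γ, ∀ X Y : C, HasCardinalLT (X ⟶ Y) β

/-! ### Finite partitions of unity in a Boolean algebra -/

section FinitePartition

variable (B : Type w) [BooleanAlgebra B]

/-- A function `f : X → B` of finite support whose values are pairwise disjoint with join `1`. -/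
structure FinitePartition (X : Type w) where
  toFun : X → B
  finite_support : {x | toFun x ≠ ⊥}.Finite
  disjoint : ∀ i j, i ≠ j → toFun i ⊓ toFun j = ⊥
  isLUB : IsLUB (Set.range toFun) ⊤

variable {B}
namespace FinitePartition

@[ext] theorem ext {X : Type w} {f g : FinitePartition B X} (h : ∀ x, f.toFun x = g.toFun x) :
    f = g := by
  cases f; cases g; congr; exact funext h

open Classical in
/-- The function `y ↦ ⋁ {f x | h x = y}`, a finite join as `f` has finite support. -/
noncomputable def push {X Y : Type w} (h : X → Y) (f : FinitePartition B X) (y : Y) : B :=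
  (f.finite_support.toFinset.filter (fun x => h x = y)).sup f.toFun

theorem push_le_iff {X Y : Type w} (h : X → Y) (f : FinitePartition B X) (y : Y) (b : B) :
    f.push h y ≤ b ↔ ∀ x, h x = y → f.toFun x ≤ b := by
  simp only [push, Finset.sup_le_iff, Finset.mem_filter, Set.Finite.mem_toFinset,
    Set.mem_ofPred_eq]
  refine ⟨fun H x hx => ?_, fun H x hx => H x hx.2⟩
  by_cases h0 : f.toFun x = ⊥
  · simp [h0]
  · exact H x ⟨h0, hx⟩

/-- Pushforward of a finite partition of unity along a map of index sets. -/
noncomputable def map {X Y : Type w} (h : X → Y) (f : FinitePartition B X) :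
    FinitePartition B Y where
  toFun := f.push h
  finite_support := by
    refine (f.finite_support.image h).subset fun y hy => ?_
    by_contra hn
    refine hy (le_bot_iff.mp ((push_le_iff h f y ⊥).mpr fun x hx => ?_))
    by_contra h0
    exact hn ⟨x, fun e => h0 e.le, hx⟩
  disjoint y z hyz := by
    rw [← disjoint_iff, ← le_compl_iff_disjoint_right, push_le_iff]
    intro x hx
    rw [le_compl_comm, push_le_iff]
    intro x' hx'
    rw [le_compl_iff_disjoint_right, disjoint_iff]
    exact f.disjoint _ _ fun e => hyz (by rw [← hx, ← hx', e])
  isLUB := by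
    refine ⟨fun _ _ => le_top, fun b hb => f.isLUB.2 ?_⟩
    rintro _ ⟨x, rfl⟩
    exact (push_le_iff h f (h x) b).mp (hb ⟨h x, rfl⟩) x rfl

end FinitePartition

/-- The functor `Set ⥤ Set` sending `X` to the set of finite partitions of unity of `B` indexed
by `X`. -/
noncomputable def finitePartitionFunctor (B : Type w) [BooleanAlgebra B] : Type w ⥤ Type w where
  obj X := FinitePartition B X
  map h := ↾(FinitePartition.map h)
  map_id X := by
    ext f x
    refine eq_of_forall_ge_iff fun b => ?_
    refine (FinitePartition.push_le_iff _ f x b).trans ?_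
    simp
  map_comp {X Y Z} h k := by
    ext f z
    refine eq_of_forall_ge_iff fun b => ?_
    refine (FinitePartition.push_le_iff _ f z b).trans ?_
    refine Iff.trans ?_ (FinitePartition.push_le_iff _ (FinitePartition.map h f) z b).symm
    constructor
    · intro H y hy
      refine (FinitePartition.push_le_iff _ f y b).mpr fun x hx => H x ?_
      simp [hx, hy]
    · intro H x hx
      exact (FinitePartition.push_le_iff _ f (h x) b).mp (H (h x) (by simpa using hx)) x rfl

end FinitePartition

attribute [local instance] Cardinal.fact_isRegular_aleph0

/-! An element of `GX` at `P` is a class of triples (A, p, f) with A in K_α, p in P(A) and f : A →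
X. Since the category of elements of `P` is α-filtered, two triples are identified exactly when a
single span relates them (`canonicalElement_eq_iff`).

If X is α-presentable, K(H-, X) is representable, so `GX` is evaluation at X and preserves every
limit.

For the converse, α-completeness of K_α makes the Ind-objects precisely the presheaves sending
α-small colimits to limits. Products of Ind-objects are therefore pointwise. Apply preservation to
products of representables. Surjectivity of the comparison map says that fewer than γ maps A_t → X
factor through one g : D → X (`exists_common_factor`). Injectivity says that fewer than γ pairs A_t
⇉ D equalized by g become equal at one further presentable E over X (`exists_common_coequalizer`).
The bounds on K_α, with regularity of γ, allow all A and all maps at once: there are D → E → X such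
that every A → X lifts to D, uniquely after passing to E. By density of K_α the lifts glue to X → E,
a section of E → X. Thus X is a retract of an α-presentable object.

For Boolean algebras, finitely presentable means finite. A partition of a finite algebra A indexed
by X is the same as a function from the two-valued homomorphisms of A to X. This identifies sets
with Ind-objects, a set X being recovered as the value at the two-element algebra, and it turns `GB`
into partitions of B. For finite B the partition functor is therefore corepresentable. For infinite
B, infinitely many two-block partitions cannot all be images of one finite partition. -/

/-! ### Elements of left Kan extensions along `C ⥤ Ind_κ(C)` -/

section LanElements

variable {C : Type u} [Category.{w} C] {κ : Cardinal.{w}}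
  [Fact κ.IsRegular]

/-- The morphism to an object `P` of `Ind_κ(C)` corresponding to an element of `P`. -/
def CardinalInd.homOfElement (P : CardinalInd C κ) {a : C} (p : P.obj.obj (op a)) :
    (CardinalInd.embedding C κ).obj a ⟶ P :=
  ObjectProperty.homMk (yonedaEquiv.symm p)

theorem CardinalInd.homOfElement_surjective {P : CardinalInd C κ} {a : C}
    (g : (CardinalInd.embedding C κ).obj a ⟶ P) : ∃ p, homOfElement P p = g :=
  ⟨yonedaEquiv g.hom, by
    ext : 1
    exact yonedaEquiv.symm_apply_apply _⟩

theorem CardinalInd.homOfElement_comp {P Q : CardinalInd C κ} {a : C} (p : P.obj.obj (op a))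
    (φ : P ⟶ Q) : homOfElement P p ≫ φ = homOfElement Q (φ.hom.app _ p) := by
  ext : 1
  apply yonedaEquiv.injective
  refine (yonedaEquiv_comp _ _).trans ?_
  exact (congrArg (φ.hom.app (op a)) (yonedaEquiv.apply_symm_apply p)).trans
    (yonedaEquiv.apply_symm_apply _).symm

theorem CardinalInd.map_comp_homOfElement {P : CardinalInd C κ} {a b : C} (u : a ⟶ b)
    (p : P.obj.obj (op b)) : (embedding C κ).map u ≫ homOfElement P p =
      homOfElement P (P.obj.map u.op p) := by
  ext : 1
  exact yonedaEquiv_symm_naturality_left u P.obj p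

theorem CardinalInd.homOfElement_injective {P : CardinalInd C κ} {a : C}
    {p q : P.obj.obj (op a)} (h : homOfElement P p = homOfElement P q) : p = q :=
  yonedaEquiv.symm.injective (congrArg (fun f => f.hom) h)

variable [EssentiallySmall.{w} C] (M : C ⥤ Type w)

/-- The element of the left Kan extension of `M` at `P` represented by elements of `P` and `M`. -/
noncomputable def lanElement (P : CardinalInd C κ) (a : C) (p : P.obj.obj (op a)) (x : M.obj a) :
    ((CardinalInd.embedding C κ).lan.obj M).obj P :=
  ((CardinalInd.embedding C κ).lan.obj M).map (CardinalInd.homOfElement P p)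
    (((CardinalInd.embedding C κ).lanUnit.app M).app a x)

/-- The left Kan extension along `C ⥤ Ind_κ(C)` is computed pointwise. -/
noncomputable def isColimitLanCocone (P : CardinalInd C κ) :
    IsColimit ((Functor.LeftExtension.mk _
      ((CardinalInd.embedding C κ).lanUnit.app M)).coconeAt P) :=
  Functor.isPointwiseLeftKanExtensionOfIsLeftKanExtension _ _ P

variable {M}

theorem map_lanElement {P Q : CardinalInd C κ} (φ : P ⟶ Q) (a : C) (p : P.obj.obj (op a))
    (x : M.obj a) : ((CardinalInd.embedding C κ).lan.obj M).map φ (lanElement M P a p x) =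
      lanElement M Q a (φ.hom.app _ p) x := by
  simp only [lanElement, ← CardinalInd.homOfElement_comp, Functor.map_comp]
  rfl

theorem lanElement_map {P : CardinalInd C κ} {a b : C} (u : a ⟶ b) (p : P.obj.obj (op b))
    (x : M.obj a) : lanElement M P b p (M.map u x) = lanElement M P a (P.obj.map u.op p) x := by
  simp only [lanElement, ← CardinalInd.map_comp_homOfElement, Functor.map_comp]
  exact congrArg _
    (ConcreteCategory.congr_hom (((CardinalInd.embedding C κ).lanUnit.app M).naturality u) x)

theorem exists_eq_lanElement {P : CardinalInd C κ}
    (y : ((CardinalInd.embedding C κ).lan.obj M).obj P) :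
    ∃ a p x, y = lanElement M P a p x := by
  obtain ⟨f, x, rfl⟩ := Types.jointly_surjective_of_isColimit (isColimitLanCocone M P) y
  obtain ⟨p, hp⟩ := CardinalInd.homOfElement_surjective f.hom
  refine ⟨f.left, p, x, ?_⟩
  unfold lanElement
  rw [hp]
  rfl

/-- The inclusion into presheaves is fully faithful, so this comma category is equivalent to the
category of elements of `P`. -/
instance (P : CardinalInd C κ) :
    IsCardinalFiltered (CostructuredArrow (CardinalInd.embedding C κ) P) κ :=
  have : IsCardinalFiltered (CostructuredArrow (CardinalInd.embedding C κ ⋙ (IsCardinalInd κ).ι)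
    ((IsCardinalInd κ).ι.obj P)) κ := P.property.isCardinalFiltered
  let T := CostructuredArrow.post (CardinalInd.embedding C κ) (IsCardinalInd κ).ι P
  IsCardinalFiltered.of_equivalence κ T.asEquivalence.symm

/-- The pointwise formula is a filtered colimit, so a zigzag of identifications collapses to one
step. -/
theorem lanElement_eq_iff {P : CardinalInd C κ} {a b : C} {p : P.obj.obj (op a)}
    {q : P.obj.obj (op b)} {x : M.obj a} {y : M.obj b} :
    lanElement M P a p x = lanElement M P b q y ↔
      ∃ (c : C) (r : P.obj.obj (op c)) (u : a ⟶ c) (v : b ⟶ c),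
        P.obj.map u.op r = p ∧ P.obj.map v.op r = q ∧ M.map u x = M.map v y := by
  refine ⟨fun h => ?_, ?_⟩
  · have := isFiltered_of_isCardinalFiltered
      (CostructuredArrow (CardinalInd.embedding C κ) P) κ
    let f := CostructuredArrow.mk (CardinalInd.homOfElement P p)
    let g := CostructuredArrow.mk (CardinalInd.homOfElement P q)
    have h' : ((Functor.LeftExtension.mk _
      ((CardinalInd.embedding C κ).lanUnit.app M)).coconeAt P).ι.app f x =
      ((Functor.LeftExtension.mk _
      ((CardinalInd.embedding C κ).lanUnit.app M)).coconeAt P).ι.app g y := by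
      exact h
    obtain ⟨k, u, v, hk⟩ :=
      (Types.FilteredColimit.isColimit_eq_iff _ (isColimitLanCocone M P)).mp h'
    obtain ⟨r, hr⟩ := CardinalInd.homOfElement_surjective k.hom
    refine ⟨k.left, r, u.left, v.left, CardinalInd.homOfElement_injective ?_,
      CardinalInd.homOfElement_injective ?_, hk⟩
    · rw [← CardinalInd.map_comp_homOfElement, hr]
      exact CostructuredArrow.w u
    · rw [← CardinalInd.map_comp_homOfElement, hr]
      exact CostructuredArrow.w v
  · rintro ⟨c, r, u, v, rfl, rfl, h⟩
    rw [← lanElement_map, h, lanElement_map]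

end LanElements

/-! ### Products in `Ind_κ(C)` -/

section Products

variable {C : Type u} [Category.{w} C] {κ : Cardinal.{w}}

/-- The presheaf `P` sends `κ`-small colimits to limits. -/
def IsCardinalContinuous (κ : Cardinal.{w}) (P : Cᵒᵖ ⥤ Type w) : Prop :=
  ∀ (A : Type w) [SmallCategory A], HasCardinalLT (Arrow A) κ → ∀ (F : A ⥤ C) (c : Cocone F),
    IsColimit c → ∀ x : ∀ a, P.obj (op (F.obj a)),
      (∀ {a b : A} (u : a ⟶ b), P.map (F.map u).op (x b) = x a) →
        ∃! y : P.obj (op c.pt), ∀ a, P.map (c.ι.app a).op y = x a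

/-- The pointwise product of a family of presheaves. -/
@[simps]
def piPresheaf {I : Type w} (P : I → Cᵒᵖ ⥤ Type w) : Cᵒᵖ ⥤ Type w where
  obj a := ∀ i, (P i).obj a
  map u := ↾fun x i => (P i).map u (x i)

theorem IsCardinalContinuous.pi {I : Type w} {P : I → Cᵒᵖ ⥤ Type w}
    (hP : ∀ i, IsCardinalContinuous κ (P i)) : IsCardinalContinuous κ (piPresheaf P) := by
  intro A _ hA F c hc x hx
  choose y hy hy' using fun i => hP i A hA F c hc (fun a => x a i) (fun u => congrFun (hx u) i)
  exact ⟨y, fun a => funext fun i => hy i a,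
    fun z hz => funext fun i => hy' i (z i) fun a => congrFun (hz a) i⟩

variable [Fact κ.IsRegular]
theorem map_yonedaEquiv_hom {P : Cᵒᵖ ⥤ Type w} {f g : CostructuredArrow yoneda P} (m : f ⟶ g) :
    P.map m.left.op (yonedaEquiv g.hom) = yonedaEquiv f.hom :=
  (yonedaEquiv_naturality _ _).trans (congrArg yonedaEquiv (CostructuredArrow.w m))

/-- A morphism of elements of a presheaf, as a morphism of the category of representables
over the presheaf. -/
def costructuredArrowHomOfElement {P : Cᵒᵖ ⥤ Type w} {a b : C} (u : a ⟶ b) {p : P.obj (op a)}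
    {q : P.obj (op b)} (h : P.map u.op q = p) :
    CostructuredArrow.mk (yonedaEquiv.symm p) ⟶ CostructuredArrow.mk (yonedaEquiv.symm q) :=
  CostructuredArrow.homMk u ((yonedaEquiv_symm_naturality_left u P q).trans (by rw [h]; rfl))

/-- A compatible family is a `κ`-small diagram of elements of `P`. A cocone on it in the filtered
category of elements induces a map from the colimit, along which the vertex restricts to the glued
element. For uniqueness, two gluings are mapped to a common element and all the resulting parallel
pairs are coequalized simultaneously. -/
theorem IsCardinalInd.isCardinalContinuous {P : Cᵒᵖ ⥤ Type w} (hP : IsCardinalInd κ P) :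
    IsCardinalContinuous κ P := by
  intro A _ hA F c hc x hx
  have := hP.isCardinalFiltered
  have := isFiltered_of_isCardinalFiltered (CostructuredArrow yoneda P) κ
  let G : A ⥤ CostructuredArrow yoneda P :=
    { obj a := CostructuredArrow.mk (yonedaEquiv.symm (x a))
      map u := costructuredArrowHomOfElement (F.map u) (hx u)
      map_id a := by ext; simp [costructuredArrowHomOfElement]
      map_comp u v := by ext; simp [costructuredArrowHomOfElement] }
  let d := IsCardinalFiltered.cocone G hA
  let e : Cocone F := (CostructuredArrow.proj yoneda P).mapCocone d
  refine existsUnique_of_exists_of_unique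
    ⟨P.map (hc.desc e).op (yonedaEquiv d.pt.hom), fun a => ?_⟩ fun y z hy hz => ?_
  · rw [← comp_apply, ← P.map_comp, ← op_comp, hc.fac]
    exact (map_yonedaEquiv_hom (d.ι.app a)).trans (yonedaEquiv.apply_symm_apply _)
  · let f := CostructuredArrow.mk (yonedaEquiv.symm y)
    let g := CostructuredArrow.mk (yonedaEquiv.symm z)
    let u : f ⟶ _ := IsFiltered.leftToMax f g
    let v : g ⟶ _ := IsFiltered.rightToMax f g
    obtain ⟨l, w, hw⟩ := IsCardinalFiltered.multicoequalizer (κ := κ)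
      (fun a => costructuredArrowHomOfElement (c.ι.app a) (hy a) ≫ u)
      (fun a => costructuredArrowHomOfElement (c.ι.app a) (hz a) ≫ v)
      (hasCardinalLT_of_hasCardinalLT_arrow hA)
    have h : (u ≫ w).left = (v ≫ w).left := hc.hom_ext fun a => by
      simpa [costructuredArrowHomOfElement] using! congrArg (fun m => m.left) (hw a)
    have h1 := map_yonedaEquiv_hom (u ≫ w)
    have h2 := map_yonedaEquiv_hom (v ≫ w)
    rw [h] at h1
    exact (yonedaEquiv.apply_symm_apply y).symm.trans (h1.symm.trans
      (h2.trans (yonedaEquiv.apply_symm_apply z)))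

/-- A `κ`-small diagram of elements has a cocone: the colimit of the underlying objects of `C`, with
the element of `P` glued by continuity. -/
theorem isCardinalInd_of_isCardinalContinuous [EssentiallySmall.{w} C]
    (hC : ∀ (A : Type w) [SmallCategory A], HasCardinalLT (Arrow A) κ → HasColimitsOfShape A C)
    {P : Cᵒᵖ ⥤ Type w} (hP : IsCardinalContinuous κ P) : IsCardinalInd κ P := by
  suffices IsCardinalFiltered (CostructuredArrow yoneda P) κ from
    isCardinalInd_of_isCardinalFiltered
  refine ⟨fun {A} _ F hA => ?_⟩
  have := hC A hA
  let G : A ⥤ C := F ⋙ CostructuredArrow.proj yoneda P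
  obtain ⟨y, hy, -⟩ := hP A hA G (colimit.cocone G) (colimit.isColimit G)
    (fun a => yonedaEquiv (F.obj a).hom) (fun u => map_yonedaEquiv_hom (F.map u))
  exact ⟨{
    pt := CostructuredArrow.mk (yonedaEquiv.symm y)
    ι :=
      { app a := CostructuredArrow.homMk (colimit.ι G a) (by
          apply yonedaEquiv.injective
          refine (yonedaEquiv_naturality _ _).symm.trans ((congrArg _ ?_).trans (hy a))
          exact yonedaEquiv.apply_symm_apply y)
        naturality a b u := by
          ext
          exact (colimit.w G u).trans (Category.comp_id _).symm } }⟩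

variable [EssentiallySmall.{w} C]
  (hC : ∀ (A : Type w) [SmallCategory A], HasCardinalLT (Arrow A) κ → HasColimitsOfShape A C)

/-- The product of a family of objects of `Ind_κ(C)`, when `C` has `κ`-small colimits. -/
def CardinalInd.pi {I : Type w} (P : I → CardinalInd C κ) : CardinalInd C κ :=
  ⟨piPresheaf fun i => (P i).obj, isCardinalInd_of_isCardinalContinuous hC
    (.pi fun i => (P i).property.isCardinalContinuous)⟩

/-- The projections of the product. -/
def CardinalInd.piFan {I : Type w} (P : I → CardinalInd C κ) : Fan P :=
  Fan.mk (pi hC P) fun i => ObjectProperty.homMk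
    { app _ := ↾fun x => x i }

/-- The pointwise product is a product in `Ind_κ(C)`. -/
def CardinalInd.isLimitPiFan {I : Type w} (P : I → CardinalInd C κ) : IsLimit (piFan hC P) :=
  Fan.IsLimit.mk _ (fun s => ObjectProperty.homMk
      { app a := ↾fun x i => (s.proj i).hom.app a x
        naturality a b u := by
          ext x
          funext i
          exact NatTrans.naturality_apply (s.proj i).hom u x })
    (fun s i => rfl)
    (fun s m hm => by
      ext a x
      funext i
      exact ConcreteCategory.congr_hom (congr_app (congrArg (fun f => f.hom) (hm i)) a) x)

end Products

/-! ### Presentable objects and products -/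

section Presentable

/-- Evaluation at an object of `C` preserves all limits that exist in `Ind_κ(C)`. -/
theorem CardinalInd.preservesLimitsOfShape_evaluation {C : Type u} [Category.{w} C]
    {κ : Cardinal.{w}} [Fact κ.IsRegular] (a : C) (I : Type w) [SmallCategory I] :
    PreservesLimitsOfShape I ((IsCardinalInd (C := C) κ).ι ⋙ (evaluation _ _).obj (op a)) := by
  -- By Yoneda, evaluation at `a` is corepresentable up to a change of universe: morphisms of
  -- presheaves on `C` form a larger type than the values of `P`. Preservation then descends along
  -- `uliftFunctor`.
  let e : ((IsCardinalInd (C := C) κ).ι ⋙ (evaluation _ _).obj (op a)) ⋙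
      uliftFunctor.{max u w} ≅ coyoneda.obj (op ((CardinalInd.embedding C κ).obj a)) :=
    NatIso.ofComponents (fun P => Equiv.toIso
      { toFun p := homOfElement P p.down
        invFun f := ⟨yonedaEquiv f.hom⟩
        left_inv p := congrArg ULift.up (yonedaEquiv.apply_symm_apply p.down)
        right_inv f := by
          exact ObjectProperty.hom_ext _ (yonedaEquiv.symm_apply_apply _) })
      (fun {P Q} φ => by
        ext p
        exact (homOfElement_comp p.down φ).symm)
  have := preservesLimitsOfShape_of_natIso (J := I) e.symm
  exact preservesLimitsOfShape_of_reflects_of_preserves _ uliftFunctor.{max u w}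

variable {K : Type u} [Category.{w} K] {α : Cardinal.{w}} [Fact α.IsRegular]
  [IsCardinalLocallyPresentable K α] {X : K}

/-- The element of `G X` at `P` represented by an element of `P` and a morphism to `X`. -/
noncomputable def canonicalElement (P : CardinalInd (PresentableObjects K α)ᵒᵖ α)
    (A : PresentableObjects K α) (p : P.obj.obj (op (op A))) (f : A.obj ⟶ X) :
    ((canonicalFunctor K α).obj X).obj.obj P :=
  lanElement ((restrictedHom K α).obj X) P (op A) p f

theorem map_canonicalElement {P Q : CardinalInd (PresentableObjects K α)ᵒᵖ α} (φ : P ⟶ Q)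
    (A : PresentableObjects K α) (p : P.obj.obj (op (op A))) (f : A.obj ⟶ X) :
    ((canonicalFunctor K α).obj X).obj.map φ (canonicalElement P A p f) =
      canonicalElement Q A (φ.hom.app _ p) f :=
  map_lanElement _ _ _ _

theorem canonicalElement_comp {P : CardinalInd (PresentableObjects K α)ᵒᵖ α}
    {A B : PresentableObjects K α} (u : A ⟶ B) (p : P.obj.obj (op (op A))) (f : B.obj ⟶ X) :
    canonicalElement P A p (u.hom ≫ f) = canonicalElement P B (P.obj.map u.op.op p) f :=
  lanElement_map (M := (restrictedHom K α).obj X) u.op p f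

theorem exists_eq_canonicalElement {P : CardinalInd (PresentableObjects K α)ᵒᵖ α}
    (y : ((canonicalFunctor K α).obj X).obj.obj P) : ∃ A p f, y = canonicalElement P A p f := by
  obtain ⟨A, p, f, h⟩ := exists_eq_lanElement (M := (restrictedHom K α).obj X) y
  exact ⟨A.unop, p, f, h⟩

theorem canonicalElement_eq_iff {P : CardinalInd (PresentableObjects K α)ᵒᵖ α}
    {A B : PresentableObjects K α} {p : P.obj.obj (op (op A))} {q : P.obj.obj (op (op B))}
    {f : A.obj ⟶ X} {g : B.obj ⟶ X} : canonicalElement P A p f = canonicalElement P B q g ↔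
      ∃ (D : PresentableObjects K α) (r : P.obj.obj (op (op D))) (u : D ⟶ A) (v : D ⟶ B),
        P.obj.map u.op.op r = p ∧ P.obj.map v.op.op r = q ∧ u.hom ≫ f = v.hom ≫ g := by
  refine lanElement_eq_iff.trans ⟨?_, ?_⟩
  · rintro ⟨D, r, u, v, h⟩
    exact ⟨D.unop, r, u.unop, v.unop, h⟩
  · rintro ⟨D, r, u, v, h⟩
    exact ⟨op D, r, u.op, v.op, h⟩

/-- Here `X` itself belongs to K_α and each triple (B, p, f) is equivalent to a unique triple with
second map `𝟙 X`. Hence `GX` is evaluation at `X`. -/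
theorem IsCardinalPresentable.preservesLimitsOfShape_canonicalFunctor
    [IsCardinalPresentable X α] (I : Type w) [SmallCategory I] :
    PreservesLimitsOfShape I ((canonicalFunctor K α).obj X).obj := by
  let A : PresentableObjects K α := ⟨X, ‹_›⟩
  let t : (IsCardinalInd α).ι ⋙ (evaluation _ _).obj (op (op A)) ⟶
      ((canonicalFunctor K α).obj X).obj :=
    { app P := ↾fun p => canonicalElement P A p (𝟙 X)
      naturality P Q φ := by
        ext p
        exact (map_canonicalElement φ A p (𝟙 X)).symm }
  have (P : CardinalInd (PresentableObjects K α)ᵒᵖ α) : IsIso (t.app P) := by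
    rw [isIso_iff_bijective]
    constructor
    · intro p q h
      obtain ⟨D, r, u, v, rfl, rfl, huv⟩ := canonicalElement_eq_iff.mp h
      have : u = v := by
        ext
        simpa [A] using huv
      rw [this]
    · intro y
      obtain ⟨B, p, f, rfl⟩ := exists_eq_canonicalElement y
      refine ⟨P.obj.map (ObjectProperty.homMk f : B ⟶ A).op.op p, ?_⟩
      refine (canonicalElement_comp _ _ _).symm.trans ?_
      exact congrArg _ (Category.comp_id f)
  have := NatIso.isIso_of_isIso_app t
  have := CardinalInd.preservesLimitsOfShape_evaluation (κ := α) (op A) I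
  exact preservesLimitsOfShape_of_natIso (asIso t)

/-- Kan extension along a fully faithful functor does not change values on representables.
Concretely, `r` is a common section of `u` and `v`. -/
theorem canonicalElement_embedding_injective {A : PresentableObjects K α} {f g : A.obj ⟶ X}
    (h : canonicalElement ((CardinalInd.embedding _ α).obj (op A)) A (𝟙 (op A)) f =
      canonicalElement ((CardinalInd.embedding _ α).obj (op A)) A (𝟙 (op A)) g) : f = g := by
  obtain ⟨D, r, u, v, hu, hv, h⟩ := canonicalElement_eq_iff.mp h
  replace hu : u.op ≫ r = 𝟙 (op A) := hu
  replace hv : v.op ≫ r = 𝟙 (op A) := hv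
  have hu' : r.unop.hom ≫ u.hom = 𝟙 A.obj := congrArg (fun m => m.unop.hom) hu
  have hv' : r.unop.hom ≫ v.hom = 𝟙 A.obj := congrArg (fun m => m.unop.hom) hv
  simpa [← Category.assoc, hu', hv'] using r.unop.hom ≫= h

theorem IsCardinalComplete.hasColimitsOfShape_op {C : Type u} [Category.{w} C]
    {κ : Cardinal.{w}} (hC : IsCardinalComplete C κ) (A : Type w) [SmallCategory A]
    (hA : HasCardinalLT (Arrow A) κ) : HasColimitsOfShape A Cᵒᵖ := by
  have := hC Aᵒᵖ (by simpa)
  exact hasColimitsOfShape_op_of_hasLimitsOfShape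

theorem existsUnique_of_preservesProduct {D : Type*} [Category* D] (F : D ⥤ Type w) {I : Type w}
    {Q : I → D} {c : Fan Q} (hc : IsLimit c) [PreservesLimitsOfShape (Discrete I) F]
    (y : ∀ i, F.obj (Q i)) : ∃! x : F.obj c.pt, ∀ i, F.map (c.proj i) x = y i := by
  let hL := isLimitOfPreserves F hc
  let s : (Discrete.functor Q ⋙ F).sections :=
    ⟨fun i => y i.as, by
      rintro ⟨i⟩ ⟨j⟩ ⟨⟨h⟩⟩
      obtain rfl : i = j := h
      simp⟩
  refine existsUnique_of_exists_of_unique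
    ⟨(Types.isLimitEquivSections hL).symm s, fun i => ?_⟩ fun x x' h h' => ?_
  · exact Types.isLimitEquivSections_symm_apply hL s ⟨i⟩
  · refine (Types.isLimitEquivSections hL).injective (Subtype.ext (funext fun i => ?_))
    exact (h i.as).trans (h' i.as).symm

/-! ### Preservation of products implies presentability -/

section

variable (hK : IsCardinalComplete (PresentableObjects K α) α) {γ : Cardinal.{w}}
  (hX : PreservesSmallProducts ((canonicalFunctor K α).obj X).obj γ)
include hK hX

/-- If `G X` preserves `γ`-small products, then fewer than `γ` morphisms from presentable objects
to `X` factor through a single one. -/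
theorem exists_common_factor {T : Type*} (hT : HasCardinalLT T γ) (A : T → PresentableObjects K α)
    (f : ∀ t, (A t).obj ⟶ X) : ∃ (D : PresentableObjects K α) (g : D.obj ⟶ X),
      ∀ t, ∃ p : A t ⟶ D, p.hom ≫ g = f t := by
  have := hT.small
  let e := equivShrink.{w} T
  let Q (i : Shrink.{w} T) : CardinalInd (PresentableObjects K α)ᵒᵖ α :=
    (CardinalInd.embedding _ α).obj (op (A (e.symm i)))
  have := hX (Shrink.{w} T) ((hasCardinalLT_iff_of_equiv e γ).mp hT)
  -- Only existence is used: `y` lies over the product of the representables at the A_t. The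
  -- `D`-component of a triple for `y` is the common object, and its element of the product is the
  -- family of lifts A_t → D.
  obtain ⟨y, hy, -⟩ := existsUnique_of_preservesProduct ((canonicalFunctor K α).obj X).obj
    (CardinalInd.isLimitPiFan hK.hasColimitsOfShape_op Q)
    (fun i => canonicalElement (Q i) (A (e.symm i)) (𝟙 (op (A (e.symm i)))) (f (e.symm i)))
  obtain ⟨D, p, g, rfl⟩ := exists_eq_canonicalElement y
  refine ⟨D, g, e.symm.surjective.forall.mpr fun i => ?_⟩
  refine ⟨(p i : op D ⟶ op (A (e.symm i))).unop, canonicalElement_embedding_injective ?_⟩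
  refine (canonicalElement_comp _ _ _).trans (Eq.trans ?_ (hy i))
  refine Eq.trans ?_ (map_canonicalElement _ _ _ _).symm
  exact congrArg (fun p => canonicalElement (Q i) D p g)
    (Category.comp_id (p i : op D ⟶ op (A (e.symm i))))

/-- If `G X` preserves `γ`-small products, then fewer than `γ` pairs of morphisms of presentable
objects that become equal in `X` become equal at a single stage. -/
theorem exists_common_coequalizer {T : Type*} (hT : HasCardinalLT T γ)
    (A : T → PresentableObjects K α) {D : PresentableObjects K α} (g : D.obj ⟶ X)
    (p q : ∀ t, A t ⟶ D) (hpq : ∀ t, (p t).hom ≫ g = (q t).hom ≫ g) :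
    ∃ (E : PresentableObjects K α) (h : D ⟶ E) (k : E.obj ⟶ X), h.hom ≫ k = g ∧
      ∀ t, p t ≫ h = q t ≫ h := by
  have := hT.small
  let e := equivShrink.{w} T
  let Q (i : Shrink.{w} T) : CardinalInd (PresentableObjects K α)ᵒᵖ α :=
    (CardinalInd.embedding _ α).obj (op (A (e.symm i)))
  have := hX (Shrink.{w} T) ((hasCardinalLT_iff_of_equiv e γ).mp hT)
  have hpi (z : ∀ i, A (e.symm i) ⟶ D) (i) : ((canonicalFunctor K α).obj X).obj.map
      ((CardinalInd.piFan hK.hasColimitsOfShape_op Q).proj i)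
      (canonicalElement (CardinalInd.pi hK.hasColimitsOfShape_op Q) D (fun i => (z i).op) g) =
        canonicalElement (Q i) (A (e.symm i)) (𝟙 _) ((z i).hom ≫ g) := by
    refine (map_canonicalElement _ _ _ _).trans (Eq.trans ?_ (canonicalElement_comp _ _ _).symm)
    exact congrArg (fun p => canonicalElement (Q i) D p g) (Category.comp_id (z i).op).symm
  -- Only uniqueness is used: the families `p` and `q` give two elements over the product with equal
  -- projections.
  have h := (existsUnique_of_preservesProduct ((canonicalFunctor K α).obj X).obj
    (CardinalInd.isLimitPiFan hK.hasColimitsOfShape_op Q) _).unique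
    (hpi fun i => p (e.symm i)) fun i => (hpi (fun i => q (e.symm i)) i).trans (by rw [hpq])
  obtain ⟨B, r, u, v, hu, hv, huv⟩ := canonicalElement_eq_iff.mp h
  -- All pairs `p t`, `q t` are composites of one family `r` with the single pair `u`, `v`.
  -- Coequalizing that pair suffices, and a finite colimit of presentable objects is presentable.
  let c := coequalizer u.hom v.hom
  have : IsCardinalPresentable c α := by
    have (i : WalkingParallelPair) :
        IsCardinalPresentable ((parallelPair u.hom v.hom).obj i) α := by
      cases i <;> dsimp <;> infer_instance
    exact isCardinalPresentable_of_isColimit _ (colimit.isColimit (parallelPair u.hom v.hom)) α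
      (hasCardinalLT_of_finite _ _ (Cardinal.IsRegular.aleph0_le Fact.out))
  let π : D ⟶ ⟨c, this⟩ := ObjectProperty.homMk (coequalizer.π _ _)
  have hπ : u ≫ π = v ≫ π := ObjectProperty.hom_ext _ (coequalizer.condition _ _)
  refine ⟨⟨c, this⟩, π, coequalizer.desc g huv,
    coequalizer.π_desc _ _, e.symm.surjective.forall.mpr fun i => ?_⟩
  let ri : op B ⟶ op (A (e.symm i)) := r i
  have hpi : u.op ≫ ri = (p (e.symm i)).op := congrFun hu i
  have hqi : v.op ≫ ri = (q (e.symm i)).op := congrFun hv i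
  rw [← (p (e.symm i)).unop_op, ← (q (e.symm i)).unop_op, ← hpi, ← hqi]
  simp [hπ]

variable (hγ : BoundsCategory (PresentableObjects K α) γ)
include hγ

/-- If there were β maps from `A` to `X`, they would all factor through one `D`. Choosing lifts
would embed a set of size β into the hom-set from `A` to `D`, which is smaller than β. -/
theorem exists_hasCardinalLT_hom : ∃ β < γ, (∀ A B : PresentableObjects K α,
    HasCardinalLT (A ⟶ B) β) ∧ ∀ A : PresentableObjects K α, HasCardinalLT (A.obj ⟶ X) β := by
  obtain ⟨β, hβ, h⟩ := hγ.homs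
  refine ⟨β, hβ, h, fun A => ?_⟩
  by_contra! hA
  rw [hasCardinalLT_iff_cardinal_mk_lt, not_lt, Cardinal.le_mk_iff_exists_set] at hA
  obtain ⟨S, hS⟩ := hA
  obtain ⟨D, g, hg⟩ := exists_common_factor hK hX (T := S)
    (by rwa [hasCardinalLT_iff_cardinal_mk_lt, hS]) (fun _ => A) (fun f => f.1)
  choose p hp using hg
  have := (h A D).of_injective p fun f f' hf => Subtype.ext (by rw [← hp, ← hp, hf])
  rw [hasCardinalLT_iff_cardinal_mk_lt, hS] at this
  exact this.false

/-- Regularity of `γ` makes the set of all maps to `X` from representatives of the isomorphism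
classes smaller than `γ`, and likewise the set of all pairs into `D`. So the two preceding
principles apply to everything at once. -/
theorem exists_factor_coequalizer : ∃ (D E : PresentableObjects K α) (h : D ⟶ E) (k : E.obj ⟶ X),
    (∀ (A : PresentableObjects K α) (f : A.obj ⟶ X), ∃ p : A ⟶ D, p.hom ≫ h.hom ≫ k = f) ∧
    (∀ (A : PresentableObjects K α) (p q : A ⟶ D),
      p.hom ≫ h.hom ≫ k = q.hom ≫ h.hom ≫ k → p ≫ h = q ≫ h) := by
  obtain ⟨β, hβ, h1, h2⟩ := exists_hasCardinalLT_hom hK hX hγ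
  have : Fact γ.IsRegular := ⟨hγ.isRegular⟩
  let R := Quotient (isIsomorphicSetoid (PresentableObjects K α))
  have iso (A : PresentableObjects K α) : Nonempty (A ≅ (Quotient.mk _ A : R).out) :=
    (isIsomorphicSetoid _).symm (Quotient.mk_out (s := isIsomorphicSetoid _) A)
  obtain ⟨D, g, hg⟩ := exists_common_factor hK hX (T := Σ r : R, (r.out.obj ⟶ X))
    (hasCardinalLT_sigma _ _ hγ.objects fun r => (h2 _).of_le hβ.le)
    (fun t => t.1.out) (fun t => t.2)
  obtain ⟨E, h, k, rfl, hk⟩ := exists_common_coequalizer hK hX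
    (T := Σ r : R, { z : (r.out ⟶ D) × (r.out ⟶ D) // z.1.hom ≫ g = z.2.hom ≫ g })
    (hasCardinalLT_sigma _ _ hγ.objects fun r =>
      (hasCardinalLT_prod hγ.isRegular.aleph0_le ((h1 _ _).of_le hβ.le)
        ((h1 _ _).of_le hβ.le)).of_injective _ Subtype.val_injective)
    (fun t => t.1.out) g (fun t => t.2.1.1) (fun t => t.2.1.2) (fun t => t.2.2)
  refine ⟨D, E, h, k, fun A f => ?_, fun A p q hpq => ?_⟩
  · obtain ⟨e⟩ := iso A
    obtain ⟨p, hp⟩ := hg ⟨_, e.inv.hom ≫ f⟩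
    refine ⟨e.hom ≫ p, ?_⟩
    dsimp at hp ⊢
    rw [Category.assoc, hp, ← Category.assoc, ← ObjectProperty.FullSubcategory.comp_hom,
      e.hom_inv_id]
    exact Category.id_comp f
  · obtain ⟨e⟩ := iso A
    have := hk ⟨_, (e.inv ≫ p, e.inv ≫ q), by simp [hpq]⟩
    simpa using this

/-- The chosen lifts to `D` need not be compatible, but they become so in `E`. Density of the
presentable objects turns them into a map from `X` to `E` that splits `k`. -/
theorem isCardinalPresentable_of_preservesSmallProducts : IsCardinalPresentable X α := by
  obtain ⟨D, E, h, k, h1, h2⟩ := exists_factor_coequalizer hK hX hγ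
  choose p hp using h1
  let ι := (isCardinalPresentable K α).ι
  let c : Cocone (CostructuredArrow.proj ι X ⋙ ι) :=
    { pt := E.obj
      ι :=
        { app f := (p f.left f.hom ≫ h).hom
          naturality f g u := by
            have hu : u.left.hom ≫ g.hom = f.hom := CostructuredArrow.w u
            have := h2 _ (u.left ≫ p g.left g.hom) (p f.left f.hom) (by simpa [hp] using hu)
            refine Eq.trans ?_ (Category.comp_id _).symm
            simpa using! congrArg (fun m => m.hom) this } }
  let hι : IsColimit ((Functor.LeftExtension.mk (𝟭 K) ι.rightUnitor.inv).coconeAt X) :=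
    ι.denseAt X
  let r : Retract X E.obj :=
    { i := hι.desc c
      r := k
      retract := hι.hom_ext fun f => by
        refine ((hι.fac_assoc c f k).trans (Eq.trans ?_ (Category.id_comp f.hom).symm)).trans
          (Category.comp_id _).symm
        exact (Category.assoc _ _ _).trans (hp f.left f.hom) }
  exact r.isCardinalPresentable α

end

end Presentable

/-! ### Colimits of Boolean algebras -/

section BoolAlgColimits

/-- The ideal whose quotient is the Boolean reflection of a commutative ring. -/
def booleanIdeal (R : Type w) [CommRing R] : Ideal R := Ideal.span (Set.range fun r => r * r - r)

instance (R : Type w) [CommRing R] : BooleanRing (R ⧸ booleanIdeal R) where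
  isIdempotentElem := by
    intro x
    obtain ⟨r, rfl⟩ := Ideal.Quotient.mk_surjective x
    exact Ideal.Quotient.eq.mpr (Ideal.subset_span ⟨r, rfl⟩)

/-- Homomorphisms from a commutative ring to a Boolean ring factor through the reflection. -/
def booleanIdealLiftEquiv (R S : Type w) [CommRing R] [BooleanRing S] :
    (R ⧸ booleanIdeal R →+* S) ≃ (R →+* S) where
  toFun f := f.comp (Ideal.Quotient.mk _)
  invFun f := Ideal.Quotient.lift _ f fun a ha =>
    (Ideal.span_le (I := RingHom.ker f)).mpr (by
      rintro _ ⟨r, rfl⟩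
      simp [BooleanRing.mul_self]) ha
  left_inv f := by ext; rfl
  right_inv f := by ext; rfl

instance : (forget₂ BoolRing.{w} CommRingCat.{w}).Full where
  map_surjective f := ⟨BoolRing.ofHom f.hom, rfl⟩

/-- The reflection supplies colimits of Boolean rings, which are carried over to Boolean algebras by
equivalence. -/
instance : (forget₂ BoolRing.{w} CommRingCat.{w}).IsRightAdjoint :=
  (Adjunction.adjunctionOfEquivLeft (G := forget₂ BoolRing.{w} CommRingCat.{w})
    (F_obj := fun R => BoolRing.of (R ⧸ booleanIdeal R))
    (fun R S =>
      { toFun f := CommRingCat.ofHom (booleanIdealLiftEquiv R S f.hom)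
        invFun f := BoolRing.ofHom ((booleanIdealLiftEquiv R S).symm f.hom)
        left_inv f := by ext; simp
        right_inv f := by ext; simp }) (fun _ _ _ _ _ => rfl)).isRightAdjoint

noncomputable instance : Reflective (forget₂ BoolRing.{w} CommRingCat.{w}) where
  L := _
  adj := Adjunction.ofIsRightAdjoint _

instance : HasColimitsOfSize.{w, w} BoolRing.{w} :=
  hasColimits_of_reflective (forget₂ BoolRing.{w} CommRingCat.{w})

instance : HasColimitsOfSize.{w, w} BoolAlg.{w} :=
  Adjunction.has_colimits_of_equivalence boolRingCatEquivBoolAlg.inverse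

/-- Every element of the colimit of commutative rings comes from a stage, where it is idempotent, so
the colimit is already Boolean. -/
instance : PreservesFilteredColimits (forget₂ BoolRing.{w} CommRingCat.{w}) where
  preserves_filtered_colimits J _ _ := ⟨fun {F} => by
    let c := colimit.cocone (F ⋙ forget₂ BoolRing.{w} CommRingCat.{w})
    let hc : IsColimit c := colimit.isColimit _
    have hid (x : c.pt) : x * x = x := by
      obtain ⟨j, y, rfl⟩ := Concrete.isColimit_exists_rep _ hc x
      have : y * y = y := BooleanRing.mul_self (α := F.obj j) y
      rw [← map_mul, this]
    let : BooleanRing c.pt := { (inferInstance : CommRing c.pt) with isIdempotentElem := hid }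
    let d : Cocone F :=
      { pt := BoolRing.of c.pt
        ι :=
          { app j := BoolRing.ofHom (c.ι.app j).hom
            naturality i j u := by
              apply (forget₂ BoolRing.{w} CommRingCat.{w}).map_injective
              exact c.ι.naturality u } }
    have e : (forget₂ BoolRing.{w} CommRingCat.{w}).mapCocone d ≅ c :=
      Cocone.ext (Iso.refl _)
    have hd : IsColimit ((forget₂ BoolRing.{w} CommRingCat.{w}).mapCocone d) :=
      IsColimit.ofIsoColimit hc e.symm
    exact preservesColimit_of_preserves_colimit_cocone (isColimitOfReflects _ hd) hd⟩

instance : PreservesFilteredColimits (forget BoolAlg.{w}) where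
  preserves_filtered_colimits J _ _ := by
    have : PreservesColimitsOfShape J (boolRingCatEquivBoolAlg.inverse ⋙
      forget₂ BoolRing.{w} CommRingCat.{w} ⋙ forget CommRingCat.{w}) := inferInstance
    exact preservesColimitsOfShape_of_natIso
      (F := boolRingCatEquivBoolAlg.inverse ⋙
        forget₂ BoolRing.{w} CommRingCat.{w} ⋙ forget CommRingCat.{w})
      (NatIso.ofComponents (fun B => Iso.refl _))

end BoolAlgColimits

/-! ### Finite Boolean algebras are the finitely presentable ones -/

section FiniteBoolAlg

/-- A finite set generates a finite sublattice by distributivity, and each element of the Boolean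
closure is a finite join of differences of elements of that sublattice. -/
theorem BooleanSubalgebra.finite_closure {B : Type*} [BooleanAlgebra B] {s : Set B}
    (hs : s.Finite) : (closure s : Set B).Finite := by
  let t := latticeClosure (s ∪ {⊥, ⊤})
  have ht : t.Finite := (hs.union (Set.toFinite _)).latticeClosure
  have : Finite t := ht
  have h1 : s ∪ {⊥, ⊤} ⊆ t := subset_latticeClosure
  refine Set.Finite.subset (s := (closure t : Set B)) ?_
    (closure_mono (Set.subset_union_left.trans h1))
  refine (Set.finite_range fun r : Finset (t × t) => r.sup fun x => x.1.1 \ x.2.1).subset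
    fun a ha => ?_
  obtain ⟨r, hr⟩ := (mem_closure_iff_sup_sdiff isSublattice_latticeClosure (h1 (by simp))
    (h1 (by simp))).mp ha
  exact ⟨r, hr.symm⟩

instance : (forget BoolAlg.{w}).ReflectsIsomorphisms where
  reflects {A B} f hf := by
    have hb := (isIso_iff_bijective _).mp hf
    have hinj : Function.Injective f := hb.1
    let e : A ≃o B := 
      { toEquiv := Equiv.ofBijective f hb
        map_rel_iff' {a b} := by
          change f a ≤ f b ↔ a ≤ b
          rw [← inf_eq_left, ← inf_eq_left, ← map_inf]
          exact hinj.eq_iff }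
    have : f = (BoolAlg.Iso.mk e).hom := rfl
    rw [this]
    infer_instance

namespace BoolAlg

/-- Finitely many equalities in a filtered colimit hold at a stage. -/
theorem exists_map_eq_of_isColimit {J : Type w} [SmallCategory J] [IsFiltered J]
    {F : J ⥤ BoolAlg.{w}} {c : Cocone F} (hc : IsColimit c) {j : J}
    {S : Set (F.obj j × F.obj j)} (hS : S.Finite)
    (h : ∀ p ∈ S, c.ι.app j p.1 = c.ι.app j p.2) :
    ∃ (k : J) (u : j ⟶ k), ∀ p ∈ S, F.map u p.1 = F.map u p.2 := by
  induction S, hS using Set.Finite.induction_on with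
  | empty => exact ⟨j, 𝟙 j, by simp⟩
  | @insert a S _ _ ih =>
    obtain ⟨k, u, hu⟩ := ih fun p hp => h p (Set.mem_insert_of_mem _ hp)
    obtain ⟨l, v, hv⟩ := (Types.FilteredColimit.isColimit_eq_iff'
      (isColimitOfPreserves (forget BoolAlg.{w}) hc) _ _).mp (h a (Set.mem_insert _ _))
    obtain ⟨m, u', v', huv⟩ := IsFilteredOrEmpty.cocone_objs k l
    obtain ⟨n, t, ht⟩ := IsFilteredOrEmpty.cocone_maps (u ≫ u') (v ≫ v')
    refine ⟨n, (u ≫ u') ≫ t, ?_⟩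
    rintro p (rfl | hp)
    · rw [ht]
      simp only [Functor.map_comp, comp_apply]
      exact congrArg _ (congrArg _ hv)
    · simp only [Functor.map_comp, comp_apply, hu p hp]

theorem isCardinalPresentable_of_finite (B : BoolAlg.{w}) [Finite B] :
    IsCardinalPresentable B Cardinal.aleph0.{w} where
  preservesColimitOfShape J _ _ := ⟨fun {F} => ⟨fun {c} hc => ⟨by
    have := isFiltered_of_isCardinalFiltered J Cardinal.aleph0.{w}
    have hB : HasCardinalLT B Cardinal.aleph0.{w} := (hasCardinalLT_aleph0_iff B).mpr ‹_›
    refine Types.FilteredColimit.isColimitOf' _ _ (fun f => ?_) (fun j f g hfg => ?_)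
    · let f' : B ⟶ c.pt := f
      choose i x hx using fun b : B => Types.jointly_surjective_of_isColimit
        (isColimitOfPreserves (forget BoolAlg.{w}) hc) (f' b)
      let j := IsCardinalFiltered.max i hB
      let z (b : B) : F.obj j := F.map (IsCardinalFiltered.toMax i hB b) (x b)
      let φ : F.obj j ⟶ c.pt := c.ι.app j
      have hz (b : B) : φ (z b) = f' b := by
        rw [← hx b]
        exact ConcreteCategory.congr_hom (c.w (IsCardinalFiltered.toMax i hB b)) (x b)
      -- The pointwise lifts `z` need not form a homomorphism. The failures are the finitely many
      -- entries of the operation tables of `B`, and all are repaired at a later stage.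
      obtain ⟨k, u, hu⟩ := exists_map_eq_of_isColimit hc
        (S := ((Set.range fun b : B × B => (z (b.1 ⊔ b.2), z b.1 ⊔ z b.2)) ∪
          (Set.range fun b : B × B => (z (b.1 ⊓ b.2), z b.1 ⊓ z b.2))) ∪
          {(z ⊤, ⊤), (z ⊥, ⊥)}) (Set.toFinite _) (by
        rintro _ ((⟨b, rfl⟩ | ⟨b, rfl⟩) | rfl | rfl)
        · exact (hz _).trans ((map_sup f'.hom _ _).trans
            ((congrArg₂ _ (hz _) (hz _)).symm.trans (map_sup φ.hom _ _).symm))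
        · exact (hz _).trans ((map_inf f'.hom _ _).trans
            ((congrArg₂ _ (hz _) (hz _)).symm.trans (map_inf φ.hom _ _).symm))
        · exact (hz _).trans ((map_top f'.hom).trans (map_top φ.hom).symm)
        · exact (hz _).trans ((map_bot f'.hom).trans (map_bot φ.hom).symm))
      let g : B ⟶ F.obj k := BoolAlg.ofHom
        { toFun b := F.map u (z b)
          map_sup' a b := (hu _ (.inl (.inl ⟨(a, b), rfl⟩))).trans (map_sup _ _ _)
          map_inf' a b := (hu _ (.inl (.inr ⟨(a, b), rfl⟩))).trans (map_inf _ _ _)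
          map_top' := (hu _ (.inr (.inl rfl))).trans (map_top _)
          map_bot' := (hu _ (.inr (.inr rfl))).trans (map_bot _) }
      refine ⟨k, g, ?_⟩
      change f' = g ≫ c.ι.app k
      ext b
      rw [← hz b]
      exact (ConcreteCategory.congr_hom (c.w u) (z b)).symm
    · let f' : B ⟶ F.obj j := f
      let g' : B ⟶ F.obj j := g
      replace hfg : f' ≫ c.ι.app j = g' ≫ c.ι.app j := hfg
      obtain ⟨k, u, hu⟩ := exists_map_eq_of_isColimit hc
        (S := Set.range fun b : B => (f' b, g' b)) (Set.toFinite _) (by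
          rintro _ ⟨b, rfl⟩
          exact ConcreteCategory.congr_hom hfg b)
      refine ⟨k, u, ?_⟩
      change f' ≫ F.map u = g' ≫ F.map u
      ext b
      exact hu _ ⟨b, rfl⟩⟩⟩⟩

/-- The finite Boolean algebras. -/
def finiteProperty : ObjectProperty BoolAlg.{w} := fun B => Finite B

/-- The directed diagram of the finitely generated subalgebras of a Boolean algebra. -/
def closureFunctor (B : BoolAlg.{w}) : Finset B ⥤ BoolAlg.{w} where
  obj s := .of (BooleanSubalgebra.closure (s : Set B))
  map u := BoolAlg.ofHom
    (BooleanSubalgebra.inclusion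
      (BooleanSubalgebra.closure_mono (Finset.coe_subset.mpr (leOfHom u))))

/-- A Boolean algebra as a cocone over its finitely generated subalgebras. -/
def closureCocone (B : BoolAlg.{w}) : Cocone (closureFunctor B) where
  pt := B
  ι := { app s := BoolAlg.ofHom (BooleanSubalgebra.subtype _) }

/-- A Boolean algebra is the directed union of its finitely generated subalgebras. -/
noncomputable def isColimitClosureCocone (B : BoolAlg.{w}) : IsColimit (closureCocone B) := by
  classical
  have := reflectsColimit_of_reflectsIsomorphisms (closureFunctor B) (forget BoolAlg.{w})
  refine isColimitOfReflects (forget BoolAlg.{w})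
    (Types.FilteredColimit.isColimitOf' _ _ (fun b => ?_) fun s x y h => ?_)
  · exact ⟨{b}, ⟨b, BooleanSubalgebra.subset_closure
      (Finset.mem_coe.mpr (Finset.mem_singleton_self b))⟩, rfl⟩
  · exact ⟨s, 𝟙 s, congrArg _ (Subtype.ext h)⟩

theorem isCardinalFilteredGenerator_finite :
    finiteProperty.{w}.IsCardinalFilteredGenerator Cardinal.aleph0.{w} where
  le_isCardinalPresentable B h :=
    have : Finite B := h
    isCardinalPresentable_of_finite B
  exists_colimitsOfShape B := by
    classical
    exact ⟨Finset B, inferInstance,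
      (isCardinalFiltered_aleph0_iff _).mpr inferInstance, ⟨{
        diag := closureFunctor B
        ι := (closureCocone B).ι
        isColimit := isColimitClosureCocone B
        prop_diag_obj s := BooleanSubalgebra.finite_closure s.finite_toSet }⟩⟩

/-- Finite algebras generate under filtered colimits, so a finitely presentable algebra is a retract
of a finite one. -/
theorem isCardinalPresentable_iff_finite (B : BoolAlg.{w}) :
    IsCardinalPresentable B Cardinal.aleph0.{w} ↔ Finite B := by
  refine ⟨fun h => ?_, fun _ => isCardinalPresentable_of_finite B⟩
  change isCardinalPresentable _ _ B at h
  rw [isCardinalFilteredGenerator_finite.isPresentable_eq_retractClosure] at h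
  obtain ⟨A, hA, ⟨r⟩⟩ := h
  have : Finite A := hA
  exact Finite.of_surjective r.r fun b => ⟨r.i b, ConcreteCategory.congr_hom r.retract b⟩

end BoolAlg

end FiniteBoolAlg

/-! ### Finite partitions of unity and homomorphisms -/

section PartitionHom

namespace FinitePartition

variable {A B : Type w} [BooleanAlgebra A] [BooleanAlgebra B] {X Y : Type w}

theorem eq_top_of_forall_le (p : FinitePartition B X) {b : B} (h : ∀ x, p.toFun x ≤ b) : b = ⊤ :=
  top_le_iff.mp (p.isLUB.2 (by rintro _ ⟨x, rfl⟩; exact h x))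

open Classical in
-- A homomorphism can shrink the support. This formula lets a partition and its image be pushed
-- forward by joins over the same finite set.
theorem push_eq_sup (h : X → Y) (p : FinitePartition B X) {t : Finset X}
    (ht : ∀ x, p.toFun x ≠ ⊥ → x ∈ t) (y : Y) :
    p.push h y = (t.filter (fun x => h x = y)).sup p.toFun := by
  refine eq_of_forall_ge_iff fun b => ?_
  rw [push_le_iff, Finset.sup_le_iff]
  refine ⟨fun H x hx => H x (Finset.mem_filter.mp hx).2, fun H x hx => ?_⟩
  by_cases h0 : p.toFun x = ⊥
  · simp [h0]
  · exact H x (Finset.mem_filter.mpr ⟨ht x h0, hx⟩)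

/-- The image of a finite partition of unity under a homomorphism of Boolean algebras. -/
def mapHom (f : BoundedLatticeHom A B) (p : FinitePartition A X) : FinitePartition B X where
  toFun x := f (p.toFun x)
  finite_support := p.finite_support.subset fun x hx h => hx (by rw [h, map_bot])
  disjoint i j hij := by rw [← map_inf, p.disjoint i j hij, map_bot]
  isLUB := by
    refine ⟨fun _ _ => le_top, fun b hb => ?_⟩
    have h : p.finite_support.toFinset.sup p.toFun = ⊤ := p.eq_top_of_forall_le fun x => by
      by_cases h0 : p.toFun x = ⊥
      · simp [h0]
      · exact Finset.le_sup ((Set.Finite.mem_toFinset _).mpr h0)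
    rw [← map_top f, ← h, map_finset_sup, Finset.sup_le_iff]
    exact fun x _ => hb ⟨x, rfl⟩

theorem map_mapHom (h : X → Y) (f : BoundedLatticeHom A B) (p : FinitePartition A X) :
    (p.mapHom f).map h = (p.map h).mapHom f := by
  classical
  ext y
  refine (push_eq_sup h (p.mapHom f) (t := p.finite_support.toFinset) (fun x hx => ?_) y).trans
    (map_finset_sup f _ _).symm
  rw [Set.Finite.mem_toFinset]
  exact fun h0 => hx ((congrArg f h0).trans (map_bot f))

/-- The partition of the power set of a finite subset of `X` by its points. -/
def points (s : Set X) [Finite s] : FinitePartition (Set s) X where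
  toFun x := {y | y.1 = x}
  finite_support := (Set.toFinite s).subset fun x hx => by
    obtain ⟨y, rfl⟩ := Set.nonempty_iff_ne_empty.mpr hx
    exact y.2
  disjoint i j hij := by
    ext y
    simpa using fun h h' => hij (h.symm.trans h')
  isLUB := ⟨fun _ _ => le_top, fun b hb y _ => hb ⟨y.1, rfl⟩ rfl⟩

section

variable (p : FinitePartition B X) (s : Set X) [Finite s]

open Classical in
/-- The join of the values of a finite partition of unity on a set. -/
noncomputable def joinOn (T : Set s) : B :=
  (Set.toFinite T).toFinset.sup fun x => p.toFun x.1

variable {s}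

theorem joinOn_le_iff {T : Set s} {b : B} :
    p.joinOn s T ≤ b ↔ ∀ x ∈ T, p.toFun x.1 ≤ b := by
  simp [joinOn]

/-- The homomorphism from a power set determined by a finite partition of unity. -/
noncomputable def toHom (hs : ∀ x, p.toFun x ≠ ⊥ → x ∈ s) : BoundedLatticeHom (Set s) B where
  toFun := p.joinOn s
  map_sup' T T' := eq_of_forall_ge_iff fun b => by
    rw [sup_le_iff, joinOn_le_iff, joinOn_le_iff, joinOn_le_iff]
    exact ⟨fun h => ⟨fun x hx => h x (.inl hx), fun x hx => h x (.inr hx)⟩,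
      fun h x hx => hx.elim (h.1 x) (h.2 x)⟩
  map_inf' T T' := by
    refine eq_of_forall_ge_iff fun b => ?_
    -- Residuation moves one factor of the meet across the inequality, so both joins can be tested
    -- term by term. The off-diagonal terms vanish by disjointness.
    rw [← le_himp_iff, joinOn_le_iff, joinOn_le_iff]
    constructor
    · intro h x hx
      rw [le_himp_iff, ← le_himp_iff', joinOn_le_iff]
      intro y hy
      rw [le_himp_iff]
      by_cases hxy : x = y
      · subst hxy
        simpa using h x ⟨hx, hy⟩
      · rw [p.disjoint _ _ fun e => hxy (Subtype.ext e.symm)]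
        exact bot_le
    · intro h x hx
      have h1 := le_himp_iff.mp (h x hx.1)
      exact (le_inf le_rfl ((p.joinOn_le_iff.mp le_rfl) x hx.2)).trans h1
  map_top' := p.eq_top_of_forall_le fun x => by
    by_cases h0 : p.toFun x = ⊥
    · simp [h0]
    · exact p.joinOn_le_iff.mp le_rfl ⟨x, hs x h0⟩ trivial
  map_bot' := le_bot_iff.mp (p.joinOn_le_iff.mpr fun x hx => hx.elim)

/-- With `hom_ext_points`, this makes `points s` universal: homomorphisms `Set s` → `B` are the
partitions of unity of `B` supported in `s`. -/
theorem mapHom_toHom_points (hs : ∀ x, p.toFun x ≠ ⊥ → x ∈ s) :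
    (points s).mapHom (p.toHom hs) = p := by
  ext x
  refine eq_of_forall_ge_iff fun b => p.joinOn_le_iff.trans ⟨fun h => ?_, fun h y hy => ?_⟩
  · by_cases h0 : p.toFun x = ⊥
    · simp [h0]
    · exact h ⟨x, hs x h0⟩ rfl
  · rw [show y.1 = x from hy]
    exact h

end

theorem hom_ext_points {s : Set X} [Finite s] {f g : BoundedLatticeHom (Set s) B}
    (h : (points s).mapHom f = (points s).mapHom g) : f = g := by
  classical
  have : Fintype s := Fintype.ofFinite s
  have h1 (x : s) : f {x} = g {x} := by
    have h2 := congrArg (fun q => q.toFun x.1) h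
    have h3 : (points s).toFun x.1 = {x} := by ext y; exact Subtype.ext_iff.symm
    change f ((points s).toFun x.1) = g ((points s).toFun x.1) at h2
    rwa [h3] at h2
  ext T
  have hT : T = (Set.toFinite T).toFinset.sup fun x => ({x} : Set s) := by
    ext x
    simp
  rw [hT, map_finset_sup, map_finset_sup]
  exact congrArg (fun q => Finset.sup _ q) (funext h1)

open Classical in
/-- The partition of unity concentrated at a point. -/
noncomputable def pure (B : Type w) [BooleanAlgebra B] (x : X) : FinitePartition B X where
  toFun y := if y = x then ⊤ else ⊥
  finite_support := (Set.finite_singleton x).subset fun y hy => by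
    by_contra h
    exact hy (if_neg h)
  disjoint i j hij := by
    by_cases h : i = x
    · rw [if_neg fun h' : j = x => hij (h.trans h'.symm), inf_bot_eq]
    · rw [if_neg h, bot_inf_eq]
  isLUB := ⟨fun _ _ => le_top, fun b hb => hb ⟨x, if_pos rfl⟩⟩

theorem pure_injective [Nontrivial B] : Function.Injective (pure B : X → FinitePartition B X) := by
  intro x y h
  by_contra hxy
  have := congrArg (fun p => p.toFun x) h
  simp [pure, hxy] at this

theorem map_pure (h : X → Y) (x : X) : (pure B x).map h = pure B (h x) := by
  ext y
  refine eq_of_forall_ge_iff fun b => (push_le_iff _ _ _ _).trans ?_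
  constructor
  · intro H
    by_cases hy : y = h x
    · simpa [pure, hy] using H x hy.symm
    · simp [pure, hy]
  · rintro H z rfl
    by_cases hz : z = x
    · subst hz
      simpa [pure] using H
    · simp [pure, hz]

theorem eq_pure_of_toFun_eq_top {p : FinitePartition B X} {x : X} (h : p.toFun x = ⊤) :
    p = pure B x := by
  ext y
  by_cases hy : y = x
  · simp [pure, hy, h]
  · have := p.disjoint x y (Ne.symm hy)
    rw [h, top_inf_eq] at this
    simp [pure, hy, this]

theorem exists_eq_pure [IsSimpleOrder B] (p : FinitePartition B X) : ∃ x, p = pure B x := by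
  by_contra! h
  refine bot_ne_top (α := B) (p.eq_top_of_forall_le fun x => ?_)
  exact ((eq_bot_or_eq_top (p.toFun x)).resolve_right fun h' => h x (eq_pure_of_toFun_eq_top h')).le

end FinitePartition

end PartitionHom

/-! ### `Ind(BoolAlg_fpᵒᵖ)` is the category of sets -/

section BoolAlgInd

namespace BoolAlg

theorem exists_iso_set (B : BoolAlg.{w}) [Finite B] :
    ∃ S : Type w, Finite S ∧ Nonempty (B ≅ .of (Set S)) := by
  classical
  have := Fintype.ofFinite B
  have e : B ≃o Set {a : B // IsAtom a} :=
    @CompleteAtomicBooleanAlgebra.toSetOfIsAtom B (Fintype.toCompleteAtomicBooleanAlgebra B)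
  exact ⟨_, inferInstance, ⟨Iso.mk e⟩⟩

instance : ObjectProperty.EssentiallySmall.{w} finiteProperty.{w} where
  exists_small_le' := by
    refine ⟨.ofObj fun n : ℕ => BoolAlg.of (Set (ULift.{w} (Fin n))), inferInstance,
      fun B hB => ?_⟩
    have : Finite B := hB
    obtain ⟨S, _, ⟨e⟩⟩ := exists_iso_set B
    obtain ⟨n, ⟨f⟩⟩ := Finite.exists_equiv_fin S
    let f' : S ≃ ULift.{w} (Fin n) := f.trans Equiv.ulift.symm
    let g : Set S ≃o Set (ULift.{w} (Fin n)) :=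
      { toEquiv := Equiv.Set.congr f'
        map_rel_iff' := Set.image_subset_image_iff f'.injective }
    exact ⟨_, .mk n, ⟨e ≪≫ Iso.mk g⟩⟩

instance isCardinalLocallyPresentable_aleph0 :
    IsCardinalLocallyPresentable BoolAlg.{w} Cardinal.aleph0.{w} where
  toHasCardinalFilteredGenerator :=
    isCardinalFilteredGenerator_finite.{w}.hasCardinalFilteredGenerator

instance (A : PresentableObjects BoolAlg.{w} Cardinal.aleph0.{w}) : Finite A.obj :=
  (isCardinalPresentable_iff_finite A.obj).mp A.property

/-- A finite Boolean algebra as a finitely presentable object. -/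
def ofFinite (B : Type w) [BooleanAlgebra B] [Finite B] :
    PresentableObjects BoolAlg.{w} Cardinal.aleph0.{w} :=
  ⟨.of B, isCardinalPresentable_of_finite (.of B)⟩

instance : IsSimpleOrder (Set PUnit.{w + 1}) where
  eq_bot_or_eq_top s := by
    obtain rfl | h := s.eq_empty_or_nonempty
    · exact .inl rfl
    · exact .inr (Subsingleton.eq_univ_of_nonempty h)

/-- The Boolean algebra with two elements. -/
abbrev two : PresentableObjects BoolAlg.{w} Cardinal.aleph0.{w} := ofFinite (Set PUnit.{w + 1})

/-- The homomorphism from a power set to the two-element Boolean algebra given by a point. -/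
def evalHom {S : Type w} (x : S) : BoundedLatticeHom (Set S) (Set PUnit.{w + 1}) :=
  (CompleteLatticeHom.setPreimage fun _ => x).toBoundedLatticeHom

/-- The image of the partition into singletons is a partition of the two-element algebra, hence
concentrated at one point, which determines the homomorphism. -/
theorem exists_eq_evalHom {S : Type w} [Finite S]
    (χ : BoundedLatticeHom (Set S) (Set PUnit.{w + 1})) : ∃ x, χ = evalHom x := by
  let p : FinitePartition (Set S) S :=
    { toFun x := {x}
      finite_support := Set.toFinite _
      disjoint i j hij := by simpa using Ne.symm hij
      isLUB := ⟨fun _ _ => le_top, fun b hb x _ => hb ⟨x, rfl⟩ rfl⟩ }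
  obtain ⟨x, hx⟩ := (p.mapHom χ).exists_eq_pure
  have hx : χ {x} = ⊤ := (congrArg (fun q => q.toFun x) hx).trans (if_pos rfl)
  refine ⟨x, DFunLike.ext _ _ fun T => ?_⟩
  by_cases h : x ∈ T
  · have h1 : χ T = ⊤ := top_le_iff.mp (hx.symm.le.trans (OrderHomClass.mono χ (by simpa using h)))
    rw [h1]
    ext
    simpa [evalHom] using h
  · have h1 : χ T = ⊥ := by
      have : T ⊓ {x} = ⊥ := by simpa using h
      rw [← inf_top_eq (χ T), ← hx, ← map_inf, this, map_bot]
    rw [h1]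
    ext
    simpa [evalHom] using h

theorem existsUnique_of_hom_two_set {S : Type w} [Finite S]
    (t : BoundedLatticeHom (Set S) (Set PUnit.{w + 1}) → Set PUnit.{w + 1}) :
    ∃! T : Set S, ∀ χ, χ T = t χ := by
  refine existsUnique_of_exists_of_unique ⟨{x | PUnit.unit ∈ t (evalHom x)}, fun χ => ?_⟩
    fun T T' h h' => Set.ext fun x => ?_
  · obtain ⟨x, rfl⟩ := exists_eq_evalHom χ
    ext
    rfl
  · have : evalHom x T = evalHom x T' := (h _).trans (h' _).symm
    exact Set.ext_iff.mp this PUnit.unit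

/-- A finite Boolean algebra is a power of the two-element Boolean algebra. -/
theorem existsUnique_of_hom_two (B : BoolAlg.{w}) [Finite B]
    (t : (B ⟶ two.obj) → Set PUnit.{w + 1}) : ∃! b : B, ∀ χ : B ⟶ two.obj, χ b = t χ := by
  obtain ⟨S, _, ⟨e⟩⟩ := exists_iso_set B
  obtain ⟨T, hT, hT'⟩ := existsUnique_of_hom_two_set (S := S) fun χ => t (e.hom ≫ ofHom χ)
  refine ⟨e.inv T, fun χ => ?_, fun b hb => ?_⟩
  · refine (hT (e.inv ≫ χ).hom).trans (congrArg t ?_)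
    exact e.hom_inv_id_assoc χ
  · rw [← hT' (e.hom b) fun χ => hb (e.hom ≫ ofHom χ)]
    simp

/-- Two-valued homomorphisms separate elements, so identities in a finite Boolean algebra may be
checked in the two-element one. -/
theorem eq_of_hom_two {B : BoolAlg.{w}} [Finite B] {a b : B}
    (h : ∀ χ : B ⟶ two.obj, χ a = χ b) : a = b :=
  (existsUnique_of_hom_two B fun χ => χ b).unique h fun _ => rfl

end BoolAlg

open BoolAlg

/-- The functor sending a set `X` to the presheaf of finite partitions of unity indexed by `X`. -/
noncomputable def partitionPresheaf : Type w ⥤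
    ((PresentableObjects BoolAlg.{w} Cardinal.aleph0.{w})ᵒᵖᵒᵖ ⥤ Type w) where
  obj X :=
    { obj A := FinitePartition A.unop.unop.obj X
      map {A B} u := ↾(FinitePartition.mapHom (A := A.unop.unop.obj) (B := B.unop.unop.obj)
        u.unop.unop.hom.hom) }
  map h :=
    { app A := ↾(FinitePartition.map (B := A.unop.unop.obj) h)
      naturality A B u := by
        ext p y
        exact congrArg (fun q => q.toFun y) (FinitePartition.map_mapHom (A := A.unop.unop.obj)
          (B := B.unop.unop.obj) h u.unop.unop.hom.hom p) }
  map_id X := NatTrans.ext (funext fun A => (finitePartitionFunctor A.unop.unop.obj).map_id X)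
  map_comp h k :=
    NatTrans.ext (funext fun A => (finitePartitionFunctor A.unop.unop.obj).map_comp h k)

/-- Two partitions are both images of `points s` for `s` the union of their supports, which bounds
any two elements. Parallel maps are merged in the same way, since homomorphisms out of `Set s` are
determined by the image of `points s`. -/
theorem isCardinalInd_partitionPresheaf (X : Type w) :
    IsCardinalInd Cardinal.aleph0.{w} (partitionPresheaf.obj X) := by
  suffices IsCardinalFiltered (CostructuredArrow yoneda (partitionPresheaf.obj X))
    Cardinal.aleph0.{w} from isCardinalInd_of_isCardinalFiltered
  rw [isCardinalFiltered_aleph0_iff]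
  have hmk (f : CostructuredArrow yoneda (partitionPresheaf.obj X)) :
      ∃ (A : PresentableObjects BoolAlg.{w} Cardinal.aleph0.{w})
        (p : (partitionPresheaf.obj X).obj (op (op A))),
        f = CostructuredArrow.mk (yonedaEquiv.symm p) :=
    ⟨f.left.unop, yonedaEquiv f.hom, by
      rw [CostructuredArrow.eq_mk f]
      simp⟩
  have : IsFilteredOrEmpty (CostructuredArrow yoneda (partitionPresheaf.obj X)) :=
    { cocone_objs f g := by
        obtain ⟨A, p, rfl⟩ := hmk f
        obtain ⟨B, q, rfl⟩ := hmk g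
        let p' : FinitePartition A.obj X := p
        let q' : FinitePartition B.obj X := q
        let s : Set X := {x | p'.toFun x ≠ ⊥} ∪ {x | q'.toFun x ≠ ⊥}
        have : Finite s := p'.finite_support.union q'.finite_support
        have hu := p'.mapHom_toHom_points (s := s) fun x hx => .inl hx
        let u := BoolAlg.ofHom (p'.toHom (s := s) fun x hx => .inl hx)
        have hv := q'.mapHom_toHom_points (s := s) fun x hx => .inr hx
        let v := BoolAlg.ofHom (q'.toHom (s := s) fun x hx => .inr hx)
        let r : (partitionPresheaf.obj X).obj (op (op (ofFinite (Set s)))) :=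
          FinitePartition.points s
        exact ⟨CostructuredArrow.mk (yonedaEquiv.symm r),
          costructuredArrowHomOfElement (ObjectProperty.homMk u : ofFinite (Set s) ⟶ A).op hu,
          costructuredArrowHomOfElement (ObjectProperty.homMk v : ofFinite (Set s) ⟶ B).op hv,
          trivial⟩
      cocone_maps f g m n := by
        obtain ⟨B, q, rfl⟩ := hmk g
        let q' : FinitePartition B.obj X := q
        let s : Set X := {x | q'.toFun x ≠ ⊥}
        have : Finite s := q'.finite_support
        have hv := q'.mapHom_toHom_points (s := s) fun x hx => hx
        let v := BoolAlg.ofHom (q'.toHom (s := s) fun x hx => hx)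
        let r : (partitionPresheaf.obj X).obj (op (op (ofFinite (Set s)))) :=
          FinitePartition.points s
        refine ⟨CostructuredArrow.mk (yonedaEquiv.symm r),
          costructuredArrowHomOfElement (ObjectProperty.homMk v : ofFinite (Set s) ⟶ B).op hv, ?_⟩
        ext
        have hq (l : f ⟶ CostructuredArrow.mk (yonedaEquiv.symm q)) :
            q'.mapHom l.left.unop.hom.hom = yonedaEquiv f.hom :=
          (congrArg (FinitePartition.mapHom l.left.unop.hom.hom)
            (yonedaEquiv.apply_symm_apply q).symm).trans (map_yonedaEquiv_hom l)
        have h : m.left.unop.hom.hom.comp v.hom = n.left.unop.hom.hom.comp v.hom :=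
          FinitePartition.hom_ext_points <|
            (congrArg (FinitePartition.mapHom m.left.unop.hom.hom) hv).trans <| (hq m).trans <|
              (hq n).symm.trans (congrArg (FinitePartition.mapHom n.left.unop.hom.hom) hv).symm
        exact Quiver.Hom.unop_inj (ObjectProperty.hom_ext _ (BoolAlg.hom_ext h)) }
  -- The one-element algebra carries a partition even when `X` is empty.
  let r : (partitionPresheaf.obj X).obj (op (op (ofFinite (Set (∅ : Set X))))) :=
    FinitePartition.points ∅
  exact { nonempty := ⟨CostructuredArrow.mk (yonedaEquiv.symm r)⟩ }

end BoolAlgInd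

/-! ### Equivalence of sets with Ind-objects, through the two-element algebra -/

section BoolAlgEquivalence

open BoolAlg

/-- The functor from sets to `Ind(BoolAlg_fpᵒᵖ)` given by finite partitions of unity. -/
noncomputable def partitionInd : Type w ⥤
    CardinalInd (PresentableObjects BoolAlg.{w} Cardinal.aleph0.{w})ᵒᵖ Cardinal.aleph0.{w} :=
  ObjectProperty.lift _ partitionPresheaf isCardinalInd_partitionPresheaf

instance : IsSimpleOrder two.{w}.obj := inferInstanceAs (IsSimpleOrder (Set PUnit.{w + 1}))

theorem FinitePartition.ext_of_hom_two {B : BoolAlg.{w}} [Finite B] {X : Type w}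
    {p q : FinitePartition B X} (h : ∀ χ : B ⟶ two.obj, p.mapHom χ.hom = q.mapHom χ.hom) :
    p = q := by
  ext x
  exact eq_of_hom_two fun χ => congrArg (fun r => r.toFun x) (h χ)

/-- The point of `X` at which a finite partition of unity is concentrated after a homomorphism to
the two-element Boolean algebra. -/
theorem FinitePartition.existsUnique_mapHom_eq_pure {B : BoolAlg.{w}} {X : Type w}
    (p : FinitePartition B X) (χ : B ⟶ two.obj) :
    ∃! x, p.mapHom χ.hom = FinitePartition.pure two.{w}.obj x :=
  existsUnique_of_exists_of_unique (p.mapHom χ.hom).exists_eq_pure fun _ _ h h' =>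
    FinitePartition.pure_injective (h.symm.trans h')

/-- Partitions of a finite algebra are functions on its spectrum: the value at `x` is the element
that each `χ` sends to ⊤ or ⊥ according to whether `t χ = x`. -/
theorem FinitePartition.existsUnique_of_hom_two {B : BoolAlg.{w}} [Finite B] {X : Type w}
    (t : (B ⟶ two.obj) → X) : ∃! p : FinitePartition B X,
      ∀ χ : B ⟶ two.obj, p.mapHom χ.hom = FinitePartition.pure two.{w}.obj (t χ) := by
  classical
  refine existsUnique_of_exists_of_unique ?_ fun p q hp hq =>
    FinitePartition.ext_of_hom_two fun χ => (hp χ).trans (hq χ).symm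
  choose b hb _ using fun x => BoolAlg.existsUnique_of_hom_two B fun χ =>
    (FinitePartition.pure two.{w}.obj (t χ)).toFun x
  have : Finite (B ⟶ two.obj) := Finite.of_injective (fun χ => (χ : B → two.obj))
    fun χ ξ h => BoolAlg.ext (congrFun h)
  refine ⟨⟨b, (Set.finite_range t).subset fun x hx => ?_, fun i j hij => ?_,
    fun _ _ => le_top, fun c hc => ?_⟩, fun χ => FinitePartition.ext fun x => hb x χ⟩
  · by_contra h
    refine hx (eq_of_hom_two fun χ => ?_)
    rw [hb x χ, map_bot]
    exact if_neg fun e => h ⟨χ, e.symm⟩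
  · refine eq_of_hom_two fun χ => ?_
    rw [map_inf, hb, hb, map_bot]
    exact FinitePartition.disjoint _ _ _ hij
  · refine top_le_iff.mpr (eq_of_hom_two fun χ => ?_)
    rw [map_top]
    refine top_le_iff.mp ?_
    have h := OrderHomClass.mono χ.hom (hc ⟨t χ, rfl⟩)
    refine le_trans (Eq.ge ?_) h
    exact (hb _ χ).trans (if_pos rfl)

section

variable {X Y : Type w}

/-- The components of a morphism between presheaves of finite partitions of unity. -/
def partitionComponent (η : partitionInd.{w}.obj X ⟶ partitionInd.obj Y)
    (A : PresentableObjects BoolAlg.{w} Cardinal.aleph0.{w}) (p : FinitePartition A.obj X) :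
    FinitePartition A.obj Y := η.hom.app (op (op A)) p

theorem partitionComponent_map (h : X ⟶ Y)
    (A : PresentableObjects BoolAlg.{w} Cardinal.aleph0.{w}) (p : FinitePartition A.obj X) :
    partitionComponent (partitionInd.map h) A p = p.map h := rfl

theorem mapHom_partitionComponent (η : partitionInd.{w}.obj X ⟶ partitionInd.obj Y)
    {A B : PresentableObjects BoolAlg.{w} Cardinal.aleph0.{w}} (f : A ⟶ B)
    (p : FinitePartition A.obj X) : (partitionComponent η A p).mapHom f.hom.hom =
      partitionComponent η B (p.mapHom f.hom.hom) :=
  (NatTrans.naturality_apply η.hom f.op.op p).symm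

theorem partitionInd_hom_ext {η θ : partitionInd.{w}.obj X ⟶ partitionInd.obj Y}
    (h : ∀ A p, partitionComponent η A p = partitionComponent θ A p) : η = θ :=
  ObjectProperty.hom_ext _ (NatTrans.ext (funext fun A =>
    ConcreteCategory.hom_ext _ _ fun p => h A.unop.unop p))

end

instance : (partitionInd.{w}).Faithful where
  map_injective {X Y} h k hhk := by
    refine ConcreteCategory.hom_ext _ _ fun x => ?_
    have h2 : partitionComponent (partitionInd.map h) two (.pure _ x) =
      partitionComponent (partitionInd.map k) two (.pure _ x) := by rw [hhk]
    rw [partitionComponent_map, partitionComponent_map, FinitePartition.map_pure,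
      FinitePartition.map_pure] at h2
    exact FinitePartition.pure_injective (B := two.obj) h2

/-- Partitions of the two-element algebra are points, so the component at `two` gives the function.
Naturality along two-valued homomorphisms forces the other components. -/
instance : (partitionInd.{w}).Full where
  map_surjective {X Y} η := by
    choose h hh using fun x =>
      (partitionComponent η two (FinitePartition.pure two.{w}.obj x)).exists_eq_pure
    refine ⟨↾h, partitionInd_hom_ext fun A p => FinitePartition.ext_of_hom_two fun χ => ?_⟩
    obtain ⟨x, hx⟩ := (p.mapHom χ.hom).exists_eq_pure
    have h1 : (partitionComponent η A p).mapHom χ.hom = partitionComponent η two (p.mapHom χ.hom) :=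
      mapHom_partitionComponent η (ObjectProperty.homMk χ) p
    rw [partitionComponent_map, h1, ← FinitePartition.map_mapHom, hx, hh]
    exact FinitePartition.map_pure _ _

/-- The cocone exhibiting the opposite of a finite Boolean algebra as a finite copower of the
opposite of the two-element one. -/
def twoCofan (A : PresentableObjects BoolAlg.{w} Cardinal.aleph0.{w}) :
    Cofan fun _ : A ⟶ two => op two :=
  Cofan.mk (op A) fun χ => χ.op

/-- A finite algebra is the power of the two-element one over its spectrum. The induced function is
a homomorphism because this can be tested by two-valued homomorphisms. -/
theorem nonempty_isColimit_twoCofan (A : PresentableObjects BoolAlg.{w} Cardinal.aleph0.{w}) :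
    Nonempty (IsColimit (twoCofan A)) := by
  have huniq (t : (A.obj ⟶ two.obj) → Set PUnit.{w + 1}) := BoolAlg.existsUnique_of_hom_two A.obj t
  have hex (D : PresentableObjects BoolAlg.{w} Cardinal.aleph0.{w}) (g : (A ⟶ two) → (D ⟶ two)) :
      ∃ k : D ⟶ A, ∀ χ, k ≫ χ = g χ := by
    choose k hk _ using fun d : D.obj => huniq fun χ => (g (ObjectProperty.homMk χ)).hom d
    let k' : BoundedLatticeHom D.obj A.obj :=
      { toFun := k
        map_sup' a b := eq_of_hom_two fun χ => by rw [hk, map_sup, map_sup, hk, hk]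
        map_inf' a b := eq_of_hom_two fun χ => by rw [hk, map_inf, map_inf, hk, hk]
        map_top' := eq_of_hom_two fun χ => by rw [hk, map_top, map_top]
        map_bot' := eq_of_hom_two fun χ => by rw [hk, map_bot, map_bot] }
    refine ⟨ObjectProperty.homMk (BoolAlg.ofHom k'), fun χ => ?_⟩
    ext d
    exact hk d χ.hom
  choose k hk using hex
  exact ⟨Cofan.IsColimit.mk _ (fun s => (k s.pt.unop fun χ => (s.inj χ).unop).op)
    (fun s χ => Quiver.Hom.unop_inj (hk s.pt.unop (fun χ => (s.inj χ).unop) χ))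
    (fun s m hm => Quiver.Hom.unop_inj (ObjectProperty.hom_ext _ (BoolAlg.ext fun d =>
      eq_of_hom_two fun χ => by
        have h1 := hm (ObjectProperty.homMk χ)
        have h2 := hk s.pt.unop (fun χ => (s.inj χ).unop) (ObjectProperty.homMk χ)
        have h3 : m.unop ≫ ObjectProperty.homMk χ =
          (k s.pt.unop fun χ => (s.inj χ).unop) ≫ ObjectProperty.homMk χ :=
          (congrArg Quiver.Hom.unop h1).trans h2.symm
        exact ConcreteCategory.congr_hom (congrArg (fun l => l.hom) h3) d)))⟩

/-- Take for `X` the value of `P` at `two`. By continuity `P` sends the finite copower `twoCofan A`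
to a product, so its value at `A` is the set of functions from the spectrum of `A` to `X`, that is,
of partitions. -/
instance : (partitionInd.{w}).EssSurj where
  mem_essImage P := by
    let X : Type w := P.obj.obj (op (op two))
    have hP := P.property.isCardinalContinuous
    have hlift (A : PresentableObjects BoolAlg.{w} Cardinal.aleph0.{w}) (t : (A ⟶ two) → X) :
        ∃! y : P.obj.obj (op (op A)), ∀ χ : A ⟶ two, P.obj.map χ.op.op y = t χ := by
      obtain ⟨hA⟩ := nonempty_isColimit_twoCofan A
      have : Finite (A ⟶ two) := Finite.of_injective (fun χ => (χ.hom : A.obj → two.obj))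
        fun χ ξ h => ObjectProperty.hom_ext _ (BoolAlg.ext (congrFun h))
      obtain ⟨y, hy, hy'⟩ := hP (Discrete (A ⟶ two))
        (hasCardinalLT_of_finite _ _ le_rfl) _ _ hA (fun χ => t χ.as) (by
          rintro ⟨χ⟩ ⟨ξ⟩ ⟨⟨h⟩⟩
          obtain rfl : χ = ξ := h
          simp)
      exact ⟨y, fun χ => hy ⟨χ⟩, fun z hz => hy' z fun χ => hz χ.as⟩
    -- an element of `P` corresponds to a partition indexed by `X`
    have hpart (A : PresentableObjects BoolAlg.{w} Cardinal.aleph0.{w})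
        (p : FinitePartition A.obj X) :
        ∃! y : P.obj.obj (op (op A)), ∀ χ : A ⟶ two,
          p.mapHom χ.hom.hom = FinitePartition.pure two.{w}.obj (P.obj.map χ.op.op y) := by
      choose t ht ht' using fun χ : A ⟶ two => p.existsUnique_mapHom_eq_pure χ.hom
      obtain ⟨y, hy, hy'⟩ := hlift A t
      exact ⟨y, fun χ => by rw [hy]; exact ht χ, fun z hz => hy' z fun χ => ht' χ _ (hz χ)⟩
    choose Φ hΦ hΦ' using hpart
    let φ : partitionInd.obj X ⟶ P := ObjectProperty.homMk
      { app A := ↾(Φ A.unop.unop)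
        naturality A B u := by
          ext p
          symm
          refine hΦ' B.unop.unop _ _ fun χ => ?_
          refine (hΦ A.unop.unop p (u.unop.unop ≫ χ)).trans ?_
          simp
          rfl }
    have hφ (A : (PresentableObjects BoolAlg.{w} Cardinal.aleph0.{w})ᵒᵖᵒᵖ) :
        IsIso (φ.hom.app A) := by
      rw [isIso_iff_bijective]
      constructor
      · intro p q hpq
        have hpq' : Φ A.unop.unop p = Φ A.unop.unop q := hpq
        refine FinitePartition.ext_of_hom_two (B := A.unop.unop.obj) fun χ => ?_
        have h1 := hΦ A.unop.unop p (ObjectProperty.homMk χ)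
        have h2 := hΦ A.unop.unop q (ObjectProperty.homMk χ)
        dsimp only at h1 h2
        rw [hpq'] at h1
        exact h1.trans h2.symm
      · intro y
        obtain ⟨p, hp, -⟩ := FinitePartition.existsUnique_of_hom_two (B := A.unop.unop.obj)
          fun χ => P.obj.map (ObjectProperty.homMk χ : A.unop.unop ⟶ two).op.op y
        exact ⟨p, (hΦ' A.unop.unop p y fun χ => hp χ.hom).symm⟩
    have : IsIso ((IsCardinalInd Cardinal.aleph0.{w}).ι.map φ) :=
      NatIso.isIso_of_isIso_app φ.hom
    have : IsIso φ := (ObjectProperty.fullyFaithfulι _).isIso_of_isIso_map φ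
    exact ⟨X, ⟨asIso φ⟩⟩

end BoolAlgEquivalence

/-! ### Identification of `GB` with partitions of unity of `B` -/

section BoolAlgCanonical

open BoolAlg

instance : (partitionInd.{w}).IsEquivalence where

variable {B : BoolAlg.{w}} {X : Type w}

/-- Two elements of the canonical functor at a presheaf of partitions agree iff they define the
same partition. -/
theorem canonicalElement_partitionInd_eq_iff
    {A A' : PresentableObjects BoolAlg.{w} Cardinal.aleph0.{w}}
    (p : FinitePartition A.obj X) (p' : FinitePartition A'.obj X)
    (f : A.obj ⟶ B) (f' : A'.obj ⟶ B) :
    canonicalElement (partitionInd.obj X) A p f = canonicalElement (partitionInd.obj X) A' p' f' ↔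
      p.mapHom f.hom = p'.mapHom f'.hom := by
  constructor
  · intro h
    obtain ⟨D, r, u, v, rfl, rfl, huv⟩ := canonicalElement_eq_iff.mp h
    exact congrArg (fun m : D.obj ⟶ B => FinitePartition.mapHom m.hom r) huv
  · intro h
    let s : Set X := {x | p.toFun x ≠ ⊥} ∪ {x | p'.toFun x ≠ ⊥}
    have : Finite s := p.finite_support.union p'.finite_support
    have hu := p.mapHom_toHom_points (s := s) fun x hx => .inl hx
    have hv := p'.mapHom_toHom_points (s := s) fun x hx => .inr hx
    -- The universal partition on the joint support is the apex of the required span.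
    refine canonicalElement_eq_iff.mpr ⟨ofFinite (Set s), FinitePartition.points s,
      ObjectProperty.homMk (BoolAlg.ofHom (p.toHom fun x hx => .inl hx)),
      ObjectProperty.homMk (BoolAlg.ofHom (p'.toHom fun x hx => .inr hx)), hu, hv, ?_⟩
    refine BoolAlg.hom_ext (FinitePartition.hom_ext_points ?_)
    exact (congrArg (FinitePartition.mapHom f.hom) hu).trans
      (h.trans (congrArg (FinitePartition.mapHom f'.hom) hv).symm)

theorem existsUnique_eq_canonicalElement
    (y : ((canonicalFunctor BoolAlg.{w} Cardinal.aleph0.{w}).obj B).obj.obj (partitionInd.obj X)) :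
    ∃! q : FinitePartition B X,
      ∀ (A : PresentableObjects BoolAlg.{w} Cardinal.aleph0.{w}) (p : FinitePartition A.obj X)
        (f : A.obj ⟶ B), y = canonicalElement (partitionInd.obj X) A p f → q = p.mapHom f.hom := by
  obtain ⟨A, p, f, rfl⟩ := exists_eq_canonicalElement y
  exact ⟨FinitePartition.mapHom (A := A.obj) f.hom p, fun A' p' f' h =>
    (canonicalElement_partitionInd_eq_iff p p' f f').mp h, fun q hq => hq A p f rfl⟩

/-- The partition of unity in `B` defined by an element of the canonical functor. -/
noncomputable def partitionOfCanonical
    (y : ((canonicalFunctor BoolAlg.{w} Cardinal.aleph0.{w}).obj B).obj.obj (partitionInd.obj X)) :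
    FinitePartition B X := (existsUnique_eq_canonicalElement y).choose

theorem partitionOfCanonical_canonicalElement
    {A : PresentableObjects BoolAlg.{w} Cardinal.aleph0.{w}} (p : FinitePartition A.obj X)
    (f : A.obj ⟶ B) : partitionOfCanonical (canonicalElement (partitionInd.obj X) A p f) =
      p.mapHom f.hom :=
  (existsUnique_eq_canonicalElement _).choose_spec.1 A p f rfl

theorem partitionOfCanonical_bijective :
    Function.Bijective (partitionOfCanonical (B := B) (X := X)) := by
  constructor
  · intro y y' h
    obtain ⟨A, p, f, rfl⟩ := exists_eq_canonicalElement y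
    obtain ⟨A', p', f', rfl⟩ := exists_eq_canonicalElement y'
    refine (canonicalElement_partitionInd_eq_iff p p' f f').mpr ?_
    exact (partitionOfCanonical_canonicalElement p f).symm.trans
      (h.trans (partitionOfCanonical_canonicalElement p' f'))
  · intro q
    let s : Set X := {x | q.toFun x ≠ ⊥}
    have : Finite s := q.finite_support
    exact ⟨canonicalElement (partitionInd.obj X) (ofFinite (Set s)) (FinitePartition.points s)
      (BoolAlg.ofHom (q.toHom fun x hx => hx)),
      (partitionOfCanonical_canonicalElement _ _).trans
        (q.mapHom_toHom_points (s := s) fun x hx => hx)⟩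

/-- On the category of sets, the functor `G B` is the functor of finite partitions of unity. -/
noncomputable def canonicalFunctorIso (B : BoolAlg.{w}) :
    partitionInd.{w} ⋙ ((canonicalFunctor BoolAlg.{w} Cardinal.aleph0.{w}).obj B).obj ≅
      finitePartitionFunctor B :=
  NatIso.ofComponents
    (fun X => (Equiv.ofBijective _ (partitionOfCanonical_bijective (B := B) (X := X))).toIso)
    fun {X Y} h => by
      refine ConcreteCategory.hom_ext _ _ fun y => ?_
      obtain ⟨A, p, f, rfl⟩ := exists_eq_canonicalElement y
      have h1 := map_canonicalElement (X := B) (partitionInd.map h) A p f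
      have h2 := partitionOfCanonical_canonicalElement (X := X) (A := A) p f
      have h3 := partitionOfCanonical_canonicalElement
        (partitionComponent (partitionInd.map h) A p) f
      refine (congrArg partitionOfCanonical h1).trans (h3.trans ?_)
      refine Eq.trans ?_ (congrArg (FinitePartition.map h) h2).symm
      exact (FinitePartition.map_mapHom _ _ _).symm

end BoolAlgCanonical

/-! ### Products of sets of finite partitions -/

section FinitePartitionProducts

open BoolAlg

/-- Finite partitions of unity in a finite Boolean algebra are functions on its spectrum. -/
theorem preservesLimitsOfShape_finitePartitionFunctor (B : BoolAlg.{w}) [Finite B] (I : Type w)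
    [SmallCategory I] : PreservesLimitsOfShape I (finitePartitionFunctor B) := by
  choose p hp hp' using fun (X : Type w) (t : (B ⟶ two.obj) → X) =>
    FinitePartition.existsUnique_of_hom_two t
  -- The functor is corepresented by the spectrum of `B`, so it preserves all limits.
  let e : coyoneda.obj (op (B ⟶ two.{w}.obj)) ≅ finitePartitionFunctor B :=
    NatIso.ofComponents (fun X => (Equiv.ofBijective (fun t : (B ⟶ two.{w}.obj) ⟶ X => p X t) (by
      constructor
      · intro t t' h
        ext χ
        have h' : p X t = p X t' := h
        refine FinitePartition.pure_injective (B := two.obj) ((hp X t χ).symm.trans ?_)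
        rw [h']
        exact hp X t' χ
      · intro q
        choose t ht _ using fun χ => q.existsUnique_mapHom_eq_pure χ
        exact ⟨↾t, (hp' X t q ht).symm⟩)).toIso) fun {X Y} h => by
      refine ConcreteCategory.hom_ext _ _ fun t => ?_
      symm
      let t' : (B ⟶ two.{w}.obj) → X := ConcreteCategory.hom (t : (B ⟶ two.{w}.obj) ⟶ X)
      refine hp' Y (fun χ => h (t' χ)) ((p X t').map h) fun χ => ?_
      rw [← FinitePartition.map_mapHom, hp]
      exact FinitePartition.map_pure _ _
  exact preservesLimitsOfShape_of_natIso e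

/-- The partition of unity of an element and its complement. -/
def FinitePartition.ofElement {B : Type w} [BooleanAlgebra B] (b : B) :
    FinitePartition B (ULift.{w} Bool) where
  toFun z := if z.down then b else bᶜ
  finite_support := Set.toFinite _
  disjoint := by
    rintro ⟨_ | _⟩ ⟨_ | _⟩ h <;> simp_all
  isLUB := by
    refine ⟨fun _ _ => le_top, fun c hc => ?_⟩
    rw [← sup_compl_eq_top (x := b)]
    exact sup_le (hc ⟨⟨true⟩, rfl⟩) (hc ⟨⟨false⟩, rfl⟩)

/-- Infinitely many distinct elements give infinitely many two-block partitions, and preservation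
assembles them into one finite partition indexed by a countable power of a two-point set. -/
theorem finite_of_preservesLimitsOfShape (B : BoolAlg.{w})
    (h : ∀ (I : Type w) [Countable I],
      PreservesLimitsOfShape (Discrete I) (finitePartitionFunctor B)) : Finite B := by
  classical
  by_contra hB
  rw [not_finite_iff_infinite] at hB
  let b : ℕ ↪ B := Infinite.natEmbedding B
  have := h (ULift.{w} ℕ)
  obtain ⟨x, hx, -⟩ := existsUnique_of_preservesProduct (finitePartitionFunctor B)
    (limit.isLimit (Discrete.functor fun _ : ULift.{w} ℕ => ULift.{w} Bool))
    fun i => FinitePartition.ofElement (b i.down)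
  let x' : FinitePartition B _ := x
  -- Each `b n` is the value at `true` of the push-forward along the n-th projection, hence a join
  -- over a subset of the finite support of `x'`. Only finitely many such joins exist.
  refine Set.infinite_range_of_injective b.injective
    ((x'.finite_support.toFinset.powerset.finite_toSet.image fun t => t.sup x'.toFun).subset ?_)
  rintro _ ⟨n, rfl⟩
  have h1 := congrArg (fun q : FinitePartition B (ULift.{w} Bool) => q.toFun ⟨true⟩) (hx ⟨n⟩)
  exact ⟨_, Finset.mem_coe.mpr (Finset.mem_powerset.mpr 
    (@Finset.filter_subset _ _ (fun _ => Classical.propDecidable _) _)), h1⟩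

end FinitePartitionProducts

theorem mainTheorem9 :
    (∀ (K : Type u) [Category.{w} K] (α : Cardinal.{w}) [Fact α.IsRegular]
      [IsCardinalLocallyPresentable K α],
      IsCardinalComplete (PresentableObjects K α) α →
      ∀ γ : Cardinal.{w}, BoundsCategory (PresentableObjects K α) γ →
      ∀ X : K, IsCardinalPresentable X α ↔
        PreservesSmallProducts ((canonicalFunctor K α).obj X).obj γ) ∧
    (∃ _ : IsCardinalLocallyPresentable BoolAlg.{w} Cardinal.aleph0.{w},
      ∃ E : Type w ≌ CardinalInd (PresentableObjects BoolAlg.{w} Cardinal.aleph0.{w})ᵒᵖ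
          Cardinal.aleph0.{w},
        ∀ B : BoolAlg.{w}, Nonempty
          (E.functor ⋙ ((canonicalFunctor BoolAlg.{w} Cardinal.aleph0.{w}).obj B).obj ≅
            finitePartitionFunctor B)) ∧
    (∀ B : BoolAlg.{w}, Finite B ↔
      ∀ (I : Type w) [Countable I],
        PreservesLimitsOfShape (Discrete I) (finitePartitionFunctor B)) := by
  refine ⟨fun K _ α _ _ hK γ hγ X => ⟨fun hX I _ => ?_, fun hX => ?_⟩, ?_,
    fun B => ⟨fun hB I _ => ?_, ?_⟩⟩
  · exact IsCardinalPresentable.preservesLimitsOfShape_canonicalFunctor (Discrete I)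
  · exact isCardinalPresentable_of_preservesSmallProducts hK hX hγ
  · exact ⟨inferInstance, partitionInd.asEquivalence, fun B => ⟨canonicalFunctorIso B⟩⟩
  · exact preservesLimitsOfShape_finitePartitionFunctor B (Discrete I)
  · exact finite_of_preservesLimitsOfShape B
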